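/- Let $\mathbb D=\{z\in\mathbb C:|z|<1\}$ and $\overline{\mathbb C}=\mathbb C\cup\{\infty\}$. For $p\in(0,1)$ let $Co(p)$ be the class of functions $f:\mathbb D\to\overline{\mathbb C}$ such that (i) $f$ is meromorphic in $\mathbb D$ and has a simple pole at the point $p$; (ii) $f(0)=0$ and $f'(0)=1$; (iii) $f$ maps $\mathbb D$ conformally (that is, injectively) onto a set whose complement with respect to $\overline{\mathbb C}$ is convex. Each $f\in Co(p)$ has a unique Laurent expansion $$f(z)=\sum_{n=-1}^{\infty}a_n(f)(z-p)^n,\qquad 0<|z-p|<1-p.$$ For $c\in\mathbb C$ with $|c|\le 1$ put $$f_c(z)=\frac{z-\frac{p}{1+p^2}(1+c)z^2}{\left(1-\frac zp\right)(1-zp)},\qquad z\in\mathbb D,$$ with $f_c(p)=\infty$. Theorem. Let $p\in(0,\sqrt3-1]$. Then the set of values $\{a_0(f): f\in Co(p)\}$ is exactly the closed disc of all $w\in\mathbb C$ with $$\left|\frac{1-p^2}{p}\,w+\frac{1-p^2+p^4}{1-p^4}\right|\le\frac{p^2(2-p^2)}{1-p^4}.$$ For $f\in Co(p)$, equality holds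 in this inequality with $w=a_0(f)$ if and only if $f=f_{e^{i\theta}}$ for some $\theta\in[0,2\pi]$. Moreover, $f_c\in Co(p)$ for every $c$ with $|c|\le1$, and every point $w$ of the disc equals $a_0(f_c)$ for some such $c$. -/

import Mathlib

open scoped Complex.UnitDisc OnePoint

noncomputable section

namespace Concave

/-- The finite part of a map from the unit disc to the Riemann sphere `OnePoint ℂ`, as a function
on `ℂ`: the value `∞` is replaced by `0`, and the function is `0` off the disc. Only its values at
points of the disc where the map is finite carry information. -/
def finitePart (f : 𝔻 → OnePoint ℂ) (z : ℂ) : ℂ :=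
  if h : ‖z‖ < 1 then (f (Complex.UnitDisc.mk z h)).elim 0 id else 0

/-- `f : 𝔻 → OnePoint ℂ` is meromorphic: it is holomorphic near every point where it is finite,
and it has a pole at every point where it takes the value `∞`. -/
def IsMeromorphic (f : 𝔻 → OnePoint ℂ) : Prop :=
  ∀ z : 𝔻,
    (f z ≠ ∞ → AnalyticAt ℂ (finitePart f) z) ∧
    (f z = ∞ → MeromorphicAt (finitePart f) z ∧ meromorphicOrderAt (finitePart f) z < 0)

/-- The class `Co(p)` of concave univalent functions with pole at `p ∈ (0, 1)`. -/
structure IsConcave (p : ℝ) (f : 𝔻 → OnePoint ℂ) : Prop where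
  meromorphic : IsMeromorphic f
  /-- `f` has a simple pole at `p` -/
  simple_pole : meromorphicOrderAt (finitePart f) (p : ℂ) = -1
  map_zero : f 0 = ((0 : ℂ) : OnePoint ℂ)
  deriv_zero : deriv (finitePart f) 0 = 1
  /-- `f` is a conformal map of the disc onto its image -/
  injective : Function.Injective f
  /-- the complement of the image in the sphere is a convex subset of the plane -/
  convex_compl : ∃ K : Set ℂ, Convex ℝ K ∧
    (Set.range f)ᶜ = (fun w : ℂ => (w : OnePoint ℂ)) '' K

/-- The class `Co(p)` as a set of functions. -/
def Co (p : ℝ) : Set (𝔻 → OnePoint ℂ) := {f | IsConcave p f}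

/-- `f(z) = ∑_{n ≥ -1} a n * (z - p) ^ n` for `0 < |z - p| < 1 - p`. -/
def HasLaurentExpansion (p : ℝ) (f : 𝔻 → OnePoint ℂ) (a : ℤ → ℂ) : Prop :=
  (∀ n : ℤ, n < -1 → a n = 0) ∧
  ∀ z : ℂ, 0 < ‖z - (p : ℂ)‖ → ‖z - (p : ℂ)‖ < 1 - p →
    HasSum (fun n : ℤ => a n * (z - (p : ℂ)) ^ n) (finitePart f z)

open Classical in
/-- The Laurent coefficients `a_n(f)` of `f` at `p` (zero if there is no expansion). -/
def laurentCoeff (p : ℝ) (f : 𝔻 → OnePoint ℂ) : ℤ → ℂ :=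
  if h : ∃ a, HasLaurentExpansion p f a then h.choose else 0

/-- The function
`z ↦ (z - p / (1 + p²) * (1 + ω(z)) * z²) / ((1 - z / p) * (1 - z * p))`
from the disc to the sphere, with its pole at `p`. -/
def rep (p : ℝ) (ω : 𝔻 → ℂ) (z : 𝔻) : OnePoint ℂ :=
  if (z : ℂ) = (p : ℂ) then ∞ else
    (((z : ℂ) - (p : ℂ) / (1 + (p : ℂ) ^ 2) * (1 + ω z) * (z : ℂ) ^ 2) /
      ((1 - (z : ℂ) / (p : ℂ)) * (1 - (z : ℂ) * (p : ℂ))) : ℂ)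

/-- The extremal functions: `rep` with the constant `exp (iθ)`. -/
def extremal (p θ : ℝ) : 𝔻 → OnePoint ℂ :=
  rep p fun _ => Complex.exp (Complex.I * (θ : ℂ))


end Concave

end

noncomputable section

namespace Concave

open Set Filter Metric Topology

/-! Every `f` in `Co p` has the form `rep p ω` with `ω` holomorphic and bounded by one; after that,
the extremal problem is Schwarz–Pick.

To get `ω`, move the pole to the origin: `F x = f (ofZero p x) = E x / x` is injective on the
punctured disc and omits a convex set. Convexity passes to the level curves: if a convex combination
of `F (μ z)` and `F (ν z)` with `|μ| = |ν| = 1` equals `F y`, then `|z| ≤ |y|`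
(`norm_le_of_combo_eq`, a Schwarz lemma for the inverse of `F` applied to that combination). To
first order this says that `(F x - F z) / (z F' z)` has nonnegative real part for `|x| = |z|`.
Taking twice the reciprocal and adding `(z + x) / (z - x)`, purely imaginary there, cancels the
singularity at `x = z` and leaves `Re (1 + 2 z x W) ≥ 0`, where `W` extends holomorphically across
the diagonal. The maximum principle in one variable at a time then gives `|W / (1 + z x W)| ≤ 1`
(`exists_two_point_function`). Freezing `z = -p`, the point where `E` vanishes, makes this an
explicit formula for `E` in terms of a bounded function, and a disc automorphism brings it to the
form `rep`.

The coefficient `a_0` is affine in `ω p` and `ω' p`. By Schwarz–Pick, with `t = |ω p|`, the centred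
coefficient is at most `R t + C (1 - t²)`, where `R = p² (2 - p²) / (1 - p⁴)` and `C = p³ / (1 -
p⁴)`. This is at most `R` for all `t ≤ 1` when `2 C ≤ R`, that is `(p + 1)² ≤ 3`; equality forces `t
= 1`, so `ω` is constant.

Conversely, for constant `c` the function is an affine image of the Joukowski map `x⁻¹ + δ x` with
`|δ| ≤ 1`, which omits a filled ellipse, possibly a segment (`exists_eq_inv_add_mul_iff`). These
functions already fill the disc of values. -/

/-! ### Injective holomorphic functions and their inverses -/

/-- An injective holomorphic function on an open set is open. -/
theorem nhds_le_map_of_injOn {U : Set ℂ} {g : ℂ → ℂ} (hU : IsOpen U)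
    (hg : DifferentiableOn ℂ g U) (hinj : InjOn g U) {z : ℂ} (hz : z ∈ U) :
    𝓝 (g z) ≤ map g (𝓝 z) := by
  rcases (hg.analyticAt (hU.mem_nhds hz)).eventually_constant_or_nhds_le_map_nhds with h | h
  · exfalso
    have h1 : ∀ᶠ w in 𝓝[≠] z, w ∈ U ∧ g w = g z :=
      ((hU.eventually_mem hz).and h).filter_mono nhdsWithin_le_nhds
    obtain ⟨w, ⟨hw, hwz⟩, hne⟩ := (h1.and self_mem_nhdsWithin).exists
    exact hne (hinj hw hz hwz)
  · exact h

/-- The inverse of an injective holomorphic function is holomorphic, and the derivative of the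
function does not vanish. -/
theorem exists_analyticAt_leftInverse {U : Set ℂ} {g : ℂ → ℂ} (hU : IsOpen U)
    (hg : DifferentiableOn ℂ g U) (hinj : InjOn g U) :
    ∃ k : ℂ → ℂ, ∀ z ∈ U, k (g z) = z ∧ AnalyticAt ℂ k (g z) ∧ deriv g z ≠ 0 := by
  obtain ⟨k, hk⟩ : ∃ k : ℂ → ℂ, ∀ z ∈ U, k (g z) = z :=
    ⟨Function.invFunOn g U, fun z hz => hinj.leftInvOn_invFunOn hz⟩
  have hcont : ∀ z ∈ U, ContinuousAt k (g z) := by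
    intro z hz
    have h1 : Tendsto (k ∘ g) (𝓝 z) (𝓝 z) :=
      tendsto_id.congr' <| by
        filter_upwards [hU.eventually_mem hz] with w hw using (hk w hw).symm
    have h2 : Tendsto k (map g (𝓝 z)) (𝓝 z) := tendsto_map'_iff.2 h1
    simpa [ContinuousAt, hk z hz] using h2.mono_left (nhds_le_map_of_injOn hU hg hinj hz)
  have hright : ∀ z ∈ U, ∀ᶠ w in 𝓝 (g z), k w ∈ U ∧ g (k w) = w := by
    intro z hz
    refine nhds_le_map_of_injOn hU hg hinj hz ?_
    rw [mem_map]
    filter_upwards [hU.eventually_mem hz] with w hw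
    simp only [mem_preimage, mem_ofPred_eq, hk w hw, hw, and_self]
  have hderiv : ∀ z ∈ U, deriv g z ≠ 0 → DifferentiableAt ℂ k (g z) := by
    intro z hz hd
    have h1 : HasDerivAt g (deriv g z) (k (g z)) := by
      rw [hk z hz]
      exact (hg.differentiableAt (hU.mem_nhds hz)).hasDerivAt
    exact (h1.of_local_left_inverse (hcont z hz) hd
      ((hright z hz).mono fun w hw => hw.2)).differentiableAt
  have hana : ∀ z ∈ U, AnalyticAt ℂ k (g z) := by
    intro z hz
    -- Zeros of `g'` are isolated, since otherwise `g` would be locally constant. So `k` is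
    -- differentiable on a punctured neighbourhood, and its continuity removes the singularity. The
    -- chain rule `k' g' = 1` afterwards excludes zeros of `g'` altogether.
    refine Complex.analyticAt_of_differentiable_on_punctured_nhds_of_continuousAt ?_ (hcont z hz)
    have hgz : AnalyticAt ℂ g z := hg.analyticAt (hU.mem_nhds hz)
    have hnz : ∀ᶠ w in 𝓝[≠] z, deriv g w ≠ 0 := by
      rcases hgz.deriv.eventually_eq_zero_or_eventually_ne_zero with h | h
      · exfalso
        obtain ⟨r, hr, hball⟩ := Metric.eventually_nhds_iff_ball.1 ((hU.eventually_mem hz).and h)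
        have hconst : ∀ w ∈ ball z r, g w = g z := by
          intro w hw
          refine (convex_ball z r).is_const_of_fderivWithin_eq_zero (𝕜 := ℂ) (f := g)
            (hg.mono fun x hx => (hball x hx).1) ?_ hw (mem_ball_self hr)
          intro x hx
          rw [fderivWithin_of_isOpen isOpen_ball hx]
          ext
          simpa using (hball x hx).2
        have h1 : ∀ᶠ w in 𝓝[≠] z, w ∈ ball z r :=
          Filter.Eventually.filter_mono nhdsWithin_le_nhds (ball_mem_nhds z hr)
        obtain ⟨w, hw, hne⟩ := (h1.and self_mem_nhdsWithin).exists
        exact hne (hinj (hball w hw).1 hz (hconst w hw))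
      · exact h
    rw [eventually_nhdsWithin_iff] at hnz ⊢
    have hkz : Tendsto k (𝓝 (g z)) (𝓝 z) := by simpa [ContinuousAt, hk z hz] using hcont z hz
    filter_upwards [hkz.eventually hnz, hright z hz] with w hw hw2 hne
    have : k w ≠ z := by
      rintro h
      exact hne (by rw [mem_singleton_iff, ← hw2.2, h])
    have := hderiv _ hw2.1 (hw this)
    rwa [hw2.2] at this
  refine ⟨k, fun z hz => ⟨hk z hz, hana z hz, fun h0 => ?_⟩⟩
  have h1 : HasDerivAt g (deriv g z) z := (hg.differentiableAt (hU.mem_nhds hz)).hasDerivAt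
  have h2 : HasDerivAt (k ∘ g) (deriv k (g z) * deriv g z) z :=
    (hana z hz).differentiableAt.hasDerivAt.comp z h1
  have h3 : HasDerivAt (k ∘ g) 1 z :=
    (hasDerivAt_id z).congr_of_eventuallyEq <| by
      filter_upwards [hU.eventually_mem hz] with w hw using hk w hw
  have := h2.unique h3
  simp [h0] at this

/-! ### Concave functions with pole at the origin: convexity of level curves -/

/-- The function `E z / z`, injective on the punctured disc with a simple pole at `0`, omits a
convex set. -/
structure ConcaveAtZero (E : ℂ → ℂ) : Prop where
  diff : DifferentiableOn ℂ E (ball 0 1)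
  ne_zero : E 0 ≠ 0
  inj : InjOn (fun z => E z / z) (ball 0 1 \ {0})
  conv : Convex ℝ ((fun z => E z / z) '' (ball 0 1 \ {0}))ᶜ

theorem isOpen_puncturedDisc : IsOpen (ball (0 : ℂ) 1 \ {0}) :=
  isOpen_ball.sdiff isClosed_singleton

theorem mem_puncturedDisc {z : ℂ} : z ∈ ball (0 : ℂ) 1 \ {0} ↔ ‖z‖ < 1 ∧ z ≠ 0 := by
  simp

namespace ConcaveAtZero

variable {E : ℂ → ℂ} (hE : ConcaveAtZero E)
include hE

theorem diff_div : DifferentiableOn ℂ (fun z => E z / z) (ball 0 1 \ {0}) :=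
  (hE.diff.mono sdiff_subset).div differentiableOn_id fun _ hz => hz.2

/-- The reciprocal `z / E z` is locally invertible at `0`, so all sufficiently large values of `E z
/ z` are taken in `|z| < 1/2`; by injectivity they are not taken again outside. -/
theorem exists_bound : ∃ B : ℝ, ∀ z : ℂ, 1 / 2 ≤ ‖z‖ → ‖z‖ < 1 → ‖E z / z‖ ≤ B := by
  have hE0 : AnalyticAt ℂ E 0 := hE.diff.analyticAt (ball_mem_nhds 0 one_pos)
  have hana : AnalyticAt ℂ (fun z => z / E z) 0 := analyticAt_id.div hE0 hE.ne_zero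
  have hd : HasDerivAt (fun z => z / E z) (1 / E 0) 0 := by
    have := (hasDerivAt_id (0 : ℂ)).div hE0.differentiableAt.hasDerivAt hE.ne_zero
    refine this.congr_deriv ?_
    have := hE.ne_zero
    simp [field]
  have hs : HasStrictDerivAt (fun z => z / E z) (1 / E 0) 0 := by
    have := hana.hasStrictDerivAt
    rwa [hd.deriv] at this
  have hmap := hs.map_nhds_eq (one_div_ne_zero hE.ne_zero)
  have hV : ball (0 : ℂ) (1 / 2) ∩ {z | E z ≠ 0} ∈ 𝓝 (0 : ℂ) :=
    inter_mem (ball_mem_nhds 0 (by norm_num)) (hE0.continuousAt.eventually_ne hE.ne_zero)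
  have himg : (fun z => z / E z) '' (ball (0 : ℂ) (1 / 2) ∩ {z | E z ≠ 0}) ∈ 𝓝 (0 : ℂ) := by
    have := image_mem_map (m := fun z => z / E z) hV
    rw [hmap] at this
    simpa using this
  obtain ⟨δ, hδ, hball⟩ := Metric.mem_nhds_iff.1 himg
  refine ⟨1 / δ, fun z hz hz1 => ?_⟩
  by_contra! hlt
  have hpos : 0 < ‖E z / z‖ := (one_div_pos.2 hδ).trans hlt
  have hmem : (E z / z)⁻¹ ∈ ball (0 : ℂ) δ := by
    rw [mem_ball_zero_iff, norm_inv]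
    exact inv_lt_of_inv_lt₀ hδ (by simpa using hlt)
  obtain ⟨w, ⟨hw, hEw⟩, hwz⟩ := hball hmem
  have hw' : ‖w‖ < 1 / 2 := by simpa using hw
  have hz0 : z ≠ 0 := by
    rintro rfl
    norm_num at hz
  have hwz' : E w / w = E z / z := by
    have := congrArg (·⁻¹) hwz
    simpa using this
  have hw0 : w ≠ 0 := by
    rintro rfl
    rw [← hwz'] at hpos
    simp at hpos
  have := hE.inj (mem_puncturedDisc.2 ⟨hw'.trans (by norm_num), hw0⟩)
    (mem_puncturedDisc.2 ⟨hz1, hz0⟩) hwz'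
  rw [this] at hw'
  linarith

/-- Cluster values at the boundary of the disc are omitted values. -/
theorem notMem_image_of_tendsto {ι : Type*} {l : Filter ι} [l.NeBot] {x : ι → ℂ} {a : ℂ}
    (hx : ∀ᶠ i in l, ‖x i‖ < 1 ∧ x i ≠ 0) (hx1 : Tendsto (fun i => ‖x i‖) l (𝓝 1))
    (ha : Tendsto (fun i => E (x i) / x i) l (𝓝 a)) :
    a ∈ ((fun z => E z / z) '' (ball 0 1 \ {0}))ᶜ := by
  rintro ⟨y, hy, rfl⟩
  have hy' := mem_puncturedDisc.1 hy
  obtain ⟨r, hyr, hr1⟩ := exists_between hy'.1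
  have hV : (ball (0 : ℂ) 1 \ {0}) ∩ ball 0 r ∈ 𝓝 y :=
    inter_mem (isOpen_puncturedDisc.mem_nhds hy) (isOpen_ball.mem_nhds (by simpa using hyr))
  have h1 : ∀ᶠ i in l, _ := ha (nhds_le_map_of_injOn isOpen_puncturedDisc hE.diff_div hE.inj hy
    (image_mem_map hV))
  have h2 := hx1.eventually (lt_mem_nhds hr1)
  obtain ⟨i, ⟨h1, h2⟩, h3⟩ := ((h1.and h2).and hx).exists
  obtain ⟨w, ⟨hw, hwr⟩, hwx⟩ := h1
  have := hE.inj hw (mem_puncturedDisc.2 h3) hwx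
  rw [this] at hwr
  simp at hwr
  linarith

/-- Near the pole, `F z = E z / z` is nearly `E 0 / z`. -/
theorem exists_radius {c : ℝ} (hc : 1 < c) : ∃ ε > 0, ε ≤ 1 ∧ ∀ z w : ℂ, ‖z‖ < ε → ‖w‖ < ε →
    ‖E z‖ < c * ‖E w‖ := by
  have hcont : ContinuousAt E 0 := (hE.diff.differentiableAt (ball_mem_nhds 0 one_pos)).continuousAt
  have h1 : Tendsto (fun x : ℂ × ℂ => c * ‖E x.2‖ - ‖E x.1‖) (𝓝 (0, 0))
      (𝓝 (c * ‖E 0‖ - ‖E 0‖)) := by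
    rw [nhds_prod_eq]
    exact ((hcont.tendsto.comp tendsto_snd).norm.const_mul c).sub
      (hcont.tendsto.comp tendsto_fst).norm
  have hpos : 0 < c * ‖E 0‖ - ‖E 0‖ := by
    have := norm_pos_iff.2 hE.ne_zero
    nlinarith
  obtain ⟨ε, hε, h⟩ := Metric.eventually_nhds_iff_ball.1 (h1.eventually (lt_mem_nhds hpos))
  refine ⟨min ε 1, by positivity, min_le_right _ _, fun z w hz hw => ?_⟩
  have := h (z, w) (by
    rw [← ball_prod_same]
    exact ⟨by simpa using hz.trans_le (min_le_left _ _), by simpa using hw.trans_le (min_le_left _ _)⟩)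
  simpa using this

/-- The sets `{F y : |y| ≥ r} ∪ K` are convex, in the form of a Schwarz lemma. -/
theorem norm_le_of_combo_eq {s t : ℝ} (hs : 0 ≤ s) (ht : 0 ≤ t) (hst : s + t = 1)
    {μ ν : ℂ} (hμ : ‖μ‖ = 1) (hν : ‖ν‖ = 1) {z y : ℂ} (hz : ‖z‖ < 1) (hz0 : z ≠ 0)
    (hy : ‖y‖ < 1) (hy0 : y ≠ 0)
    (heq : s * (E (μ * z) / (μ * z)) + t * (E (ν * z) / (ν * z)) = E y / y) : ‖z‖ ≤ ‖y‖ := by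
  set F : ℂ → ℂ := fun z => E z / z with hF
  set D : Set ℂ := ball 0 1 \ {0} with hD
  set M : ℂ → ℂ := fun z => s * F (μ * z) + t * F (ν * z) with hM
  have hmul : ∀ {κ : ℂ}, ‖κ‖ = 1 → ∀ {x}, x ∈ D → κ * x ∈ D := by
    intro κ hκ x hx
    rw [mem_puncturedDisc] at hx ⊢
    refine ⟨by simpa [hκ] using hx.1, mul_ne_zero ?_ hx.2⟩
    rintro rfl
    simp at hκ
  have hMd : DifferentiableOn ℂ M D := by
    have h : ∀ {κ : ℂ}, ‖κ‖ = 1 → DifferentiableOn ℂ (fun x => F (κ * x)) D := fun hκ =>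
      hE.diff_div.comp (differentiableOn_id.const_mul _) fun x hx => hmul hκ hx
    exact ((h hμ).const_mul _).add ((h hν).const_mul _)
  obtain ⟨k, hk⟩ := exists_analyticAt_leftInverse isOpen_puncturedDisc hE.diff_div hE.inj
  have hFo : IsOpen (F '' D) := by
    rw [isOpen_iff_mem_nhds]
    rintro _ ⟨x, hx, rfl⟩
    exact nhds_le_map_of_injOn isOpen_puncturedDisc hE.diff_div hE.inj hx
      (image_mem_map (isOpen_puncturedDisc.mem_nhds hx))
  set N : Set ℂ := D ∩ M ⁻¹' (F '' D) with hN
  have hNo : IsOpen N := hMd.continuousOn.isOpen_inter_preimage isOpen_puncturedDisc hFo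
  set h : ℂ → ℂ := fun x => k (M x) with hh
  have hhN : ∀ x ∈ N, h x ∈ D ∧ F (h x) = M x := by
    rintro x ⟨hx, w, hw, hwx⟩
    have : h x = w := by
      simp only [hh, ← hwx]
      exact (hk w hw).1
    rw [this]
    exact ⟨hw, hwx⟩
  have hhd : DifferentiableOn ℂ h N := by
    intro x hx
    obtain ⟨hx1, w, hw, hwx⟩ := id hx
    have h1 : DifferentiableAt ℂ k (M x) := by
      rw [← hwx]; exact (hk w hw).2.1.differentiableAt
    exact (h1.comp x (hMd.differentiableAt (isOpen_puncturedDisc.mem_nhds hx1))).differentiableWithinAt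
  by_contra! hlt
  have hypos : 0 < ‖y‖ := norm_pos_iff.2 hy0
  -- The slack `c > 1` is what keeps the bad set `U`, where `c |h x| < |x|`, away from both the pole
  -- and the unit circle; there `h` is the inverse of `F` applied to the combination `M`.
  obtain ⟨c, hc1, hc2⟩ := exists_between ((one_lt_div hypos).2 hlt)
  rw [lt_div_iff₀ hypos] at hc2
  have hc0 : 0 < c := one_pos.trans hc1
  set U : Set ℂ := N ∩ {x | c * ‖h x‖ < ‖x‖} with hU
  have hzU : z ∈ U := by
    have hyD : y ∈ D := mem_puncturedDisc.2 ⟨hy, hy0⟩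
    have hMz : M z = F y := heq
    refine ⟨⟨mem_puncturedDisc.2 ⟨hz, hz0⟩, y, hyD, hMz.symm⟩, ?_⟩
    have : h z = y := by rw [hh]; simp only [hMz]; exact (hk y hyD).1
    simpa [this] using hc2
  obtain ⟨ε, hε, hε1, hεE⟩ := hE.exists_radius hc1
  -- Near the pole `|M x|` is at most `c |E (h x)| / |x|`, while it equals `|E (h x)| / |h x|`;
  -- hence `|x| ≤ c |h x|`.
  have hUε : ∀ x ∈ U, ε ≤ ‖x‖ := by
    rintro x ⟨hxN, hxc⟩
    by_contra! hxε
    have hxD := mem_puncturedDisc.1 hxN.1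
    have hhx := hhN x hxN
    have hhD := mem_puncturedDisc.1 hhx.1
    have hxpos := norm_pos_iff.2 hxD.2
    have hhpos := norm_pos_iff.2 hhD.2
    simp only [mem_ofPred_eq] at hxc
    have hhε : ‖h x‖ < ε := by nlinarith
    have hb : ∀ {κ : ℂ}, ‖κ‖ = 1 → ‖F (κ * x)‖ ≤ c * ‖E (h x)‖ / ‖x‖ := by
      intro κ hκ
      rw [hF]
      simp only [norm_div, norm_mul, hκ, one_mul]
      gcongr
      exact (hεE _ _ (by simpa [hκ] using hxε) hhε).le
    have h1 : ‖M x‖ ≤ c * ‖E (h x)‖ / ‖x‖ := by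
      calc ‖M x‖ ≤ ‖(s : ℂ) * F (μ * x)‖ + ‖(t : ℂ) * F (ν * x)‖ := norm_add_le _ _
        _ = s * ‖F (μ * x)‖ + t * ‖F (ν * x)‖ := by
          simp [abs_of_nonneg hs, abs_of_nonneg ht]
        _ ≤ s * (c * ‖E (h x)‖ / ‖x‖) + t * (c * ‖E (h x)‖ / ‖x‖) := by
          gcongr
          · exact hb hμ
          · exact hb hν
        _ = c * ‖E (h x)‖ / ‖x‖ := by rw [← add_mul, hst, one_mul]
    rw [← hhx.2, hF] at h1
    simp only [norm_div] at h1
    have hEpos : 0 < ‖E (h x)‖ := by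
      have := hεE (h x) (h x) hhε hhε
      by_contra! hcon
      nlinarith [norm_nonneg (E (h x))]
    rw [div_le_div_iff₀ hhpos hxpos] at h1
    nlinarith
  obtain ⟨B, hB⟩ := hE.exists_bound
  -- The closure of `U` stays in the domain `N` of `h`. Along an ultrafilter in `U` the values `h`
  -- stay in `|w| ≤ 1/c < 1`, so they converge to a point `w` of the open disc.
  have hclos : ∀ x ∈ closure U, x ∈ N ∧ c * ‖h x‖ ≤ ‖x‖ := by
    intro x hx
    obtain ⟨u, huU, hux⟩ := mem_closure_iff_ultrafilter.1 hx
    have hUev : ∀ᶠ w in (u : Filter ℂ), w ∈ U := huU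
    have hid : Tendsto id (u : Filter ℂ) (𝓝 x) := hux
    have hxε : ε ≤ ‖x‖ := ge_of_tendsto hid.norm (hUev.mono hUε)
    have hx0 : x ≠ 0 := by
      rintro rfl
      simp at hxε
      linarith
    have hx1 : ‖x‖ ≤ 1 := le_of_tendsto hid.norm
      (hUev.mono fun w hw => (mem_puncturedDisc.1 hw.1.1).1.le)
    have hcpt : ∃ w ∈ closedBall (0 : ℂ) (1 / c), Tendsto h (u : Filter ℂ) (𝓝 w) := by
      have hmem : closedBall (0 : ℂ) (1 / c) ∈ u.map h := by
        rw [Ultrafilter.mem_map]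
        filter_upwards [hUev] with w hw
        have h1 : c * ‖h w‖ < ‖w‖ := hw.2
        have h2 := (mem_puncturedDisc.1 hw.1.1).1
        simp only [mem_preimage, mem_closedBall_zero_iff]
        rw [le_div_iff₀ hc0]
        linarith
      exact (isCompact_closedBall (0 : ℂ) (1 / c)).ultrafilter_le_nhds' (u.map h) hmem
    obtain ⟨w, hwc, hwt⟩ := hcpt
    have hw1 : ‖w‖ < 1 := by
      have : ‖w‖ ≤ 1 / c := by simpa using hwc
      exact this.trans_lt ((div_lt_one hc0).2 hc1)
    have hwx : c * ‖w‖ ≤ ‖x‖ := le_of_tendsto_of_tendsto (hwt.norm.const_mul c) hid.norm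
      (hUev.mono fun v hv => le_of_lt hv.2)
    have hEw : Tendsto (fun v => E (h v)) (u : Filter ℂ) (𝓝 (E w)) :=
      (hE.diff.differentiableAt (isOpen_ball.mem_nhds (by simpa using hw1))).continuousAt.tendsto.comp
        hwt
    -- Passing to the limit in `h v * M v = E (h v)` avoids dividing by `h v`, and `E 0 ≠ 0` then
    -- excludes `w = 0`.
    have hlim : ∀ m : ℂ, Tendsto M (u : Filter ℂ) (𝓝 m) → w ≠ 0 ∧ F w = m := by
      intro m hm
      have h1 : w * m = E w := by
        refine tendsto_nhds_unique (hwt.mul hm) (hEw.congr' ?_)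
        filter_upwards [hUev] with v hv
        obtain ⟨h2, h3⟩ := hhN v hv.1
        rw [← h3, hF]
        have := h2.2
        simp only [mem_singleton_iff] at this
        simp only
        field_simp
      have hw0 : w ≠ 0 := by
        rintro rfl
        rw [zero_mul] at h1
        exact hE.ne_zero h1.symm
      refine ⟨hw0, ?_⟩
      rw [hF]
      simp only
      rw [← h1]
      field_simp
    rcases hx1.lt_or_eq with hx1 | hx1
    · have hxD : x ∈ D := mem_puncturedDisc.2 ⟨hx1, hx0⟩
      have hMx : ContinuousAt M x :=
        (hMd.differentiableAt (isOpen_puncturedDisc.mem_nhds hxD)).continuousAt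
      obtain ⟨hw0, hwM⟩ := hlim (M x) (hMx.tendsto.comp hid)
      have hwD : w ∈ D := mem_puncturedDisc.2 ⟨hw1, hw0⟩
      refine ⟨⟨hxD, w, hwD, hwM⟩, ?_⟩
      have : h x = w := by rw [hh]; simp only [← hwM]; exact (hk w hwD).1
      rwa [this]
    · exfalso
      -- A limit point on the unit circle is impossible: there both terms of `M` tend to omitted
      -- values, so by convexity the limit of `M` is omitted, yet it equals `F w`.
      have hcl : ∀ {κ : ℂ}, ‖κ‖ = 1 → ∃ a ∈ (F '' D)ᶜ,
          Tendsto (fun v => F (κ * v)) (u : Filter ℂ) (𝓝 a) := by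
        intro κ hκ
        have hhalf : ∀ᶠ v in (u : Filter ℂ), 1 / 2 < ‖v‖ :=
          hid.norm.eventually (lt_mem_nhds (by rw [hx1]; norm_num))
        have hmem : closedBall (0 : ℂ) B ∈ u.map fun v => F (κ * v) := by
          rw [Ultrafilter.mem_map]
          filter_upwards [hUev, hhalf] with v hv hv2
          have := (mem_puncturedDisc.1 hv.1.1).1
          simpa only [mem_preimage, mem_closedBall_zero_iff] using
            hB (κ * v) (by simpa [hκ] using hv2.le) (by simpa [hκ] using this)
        obtain ⟨a, -, ha⟩ := (isCompact_closedBall (0 : ℂ) B).ultrafilter_le_nhds' _ hmem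
        refine ⟨a, hE.notMem_image_of_tendsto (l := (u : Filter ℂ)) (x := fun v => κ * v) ?_ ?_ ha,
          ha⟩
        · filter_upwards [hUev] with v hv using mem_puncturedDisc.1 (hmul hκ hv.1.1)
        · simpa [hκ, hx1] using hid.norm
      obtain ⟨a, haK, ha⟩ := hcl hμ
      obtain ⟨b, hbK, hb⟩ := hcl hν
      have hMt : Tendsto M (u : Filter ℂ) (𝓝 (s * a + t * b)) :=
        (ha.const_mul _).add (hb.const_mul _)
      obtain ⟨hw0, hwM⟩ := hlim _ hMt
      have hK : (s * a + t * b : ℂ) ∈ (F '' D)ᶜ := by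
        simpa only [Complex.real_smul] using hE.conv haK hbK hs ht hst
      exact hK ⟨w, mem_puncturedDisc.2 ⟨hw1, hw0⟩, hwM⟩
  have hUb : Bornology.IsBounded U :=
    isBounded_ball.subset fun x hx => hx.1.1.1
  have hUo : IsOpen U := by
    have h1 : ContinuousOn (fun x => ‖x‖ - c * ‖h x‖) N :=
      continuous_norm.continuousOn.sub (continuousOn_const.mul hhd.continuousOn.norm)
    convert h1.isOpen_inter_preimage hNo (isOpen_Ioi (a := 0)) using 1
    ext x
    simp [hU, sub_pos]
  have hdcl : DiffContOnCl ℂ (fun x => x / h x) U := by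
    refine DifferentiableOn.diffContOnCl ?_
    refine differentiableOn_id.div (hhd.mono fun x hx => (hclos x hx).1) fun x hx => ?_
    exact (hhN x (hclos x hx).1).1.2
  have hfr : ∀ x ∈ frontier U, ‖x / h x‖ ≤ c := by
    intro x hx
    rw [hUo.frontier_eq] at hx
    obtain ⟨hxN, -⟩ := hclos x hx.1
    have : ¬ c * ‖h x‖ < ‖x‖ := fun hcon => hx.2 ⟨hxN, hcon⟩
    rw [norm_div, div_le_iff₀ (norm_pos_iff.2 (hhN x hxN).1.2)]
    linarith
  -- On the frontier `|x / h x| ≤ c`, so the maximum principle gives the same bound inside `U`,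
  -- contrary to the definition of `U`.
  have hfin := Complex.norm_le_of_forall_mem_frontier_norm_le hUb hdcl hfr (subset_closure hzU)
  rw [norm_div, div_le_iff₀ (norm_pos_iff.2 (hhN z hzU.1).1.2)] at hfin
  exact absurd hzU.2 (not_lt.2 hfin)

end ConcaveAtZero

/-! ### Half-plane conditions and the maximum principle on circles -/

/-- This rests on `|1 + a|² - |a|² = Re (1 + 2 a)`; it turns a half-plane condition into a bound by
one. -/
theorem norm_div_one_add_le_one {a : ℂ} (ha : 0 ≤ (1 + 2 * a).re) : ‖a / (1 + a)‖ ≤ 1 := by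
  have h : ‖a‖ ≤ ‖1 + a‖ := by
    rw [← sq_le_sq₀ (norm_nonneg _) (norm_nonneg _), Complex.sq_norm, Complex.sq_norm,
      Complex.normSq_apply, Complex.normSq_apply]
    simp at ha ⊢
    nlinarith
  rw [norm_div]
  exact div_le_one_of_le₀ h (norm_nonneg _)

theorem one_add_ne_zero_of_re_nonneg {a : ℂ} (ha : 0 ≤ (1 + 2 * a).re) : 1 + a ≠ 0 := by
  intro h
  have h1 : a = -1 := by linear_combination h
  rw [h1] at ha
  norm_num at ha

/-- A closed condition on a circle may be checked away from one point. -/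
theorem re_nonneg_of_forall_ne {g : ℂ → ℂ} {x₀ : ℂ} (hx₀ : x₀ ≠ 0) (hg : ContinuousAt g x₀)
    (h : ∀ x, ‖x‖ = ‖x₀‖ → x ≠ x₀ → 0 ≤ (g x).re) : 0 ≤ (g x₀).re := by
  have hden : ∀ s : ℝ, (1 - s * Complex.I : ℂ) ≠ 0 := by
    intro s hs
    simpa using congrArg Complex.re hs
  -- The Cayley transform of the real line parametrizes the circle through `x₀`, with `s = 0` giving
  -- `x₀` itself.
  have hc : Tendsto (fun s : ℝ => x₀ * ((1 + s * Complex.I) / (1 - s * Complex.I))) (𝓝[≠] 0)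
      (𝓝 x₀) := by
    have : ContinuousAt (fun s : ℝ => x₀ * ((1 + s * Complex.I) / (1 - s * Complex.I))) 0 := by
      refine continuousAt_const.mul (ContinuousAt.div (by fun_prop) (by fun_prop) (hden 0))
    have h2 := this.tendsto
    simp only [Complex.ofReal_zero, zero_mul, add_zero, sub_zero, div_one, mul_one] at h2
    exact h2.mono_left nhdsWithin_le_nhds
  refine ge_of_tendsto (Complex.continuous_re.continuousAt.tendsto.comp (hg.tendsto.comp hc)) ?_
  filter_upwards [self_mem_nhdsWithin] with s hs
  refine h _ ?_ ?_
  · have h1 : (1 - s * Complex.I : ℂ) = (starRingEnd ℂ) (1 + s * Complex.I) := by simp [sub_eq_add_neg]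
    have h2 : ‖(1 + s * Complex.I : ℂ)‖ ≠ 0 := by
      rw [← RCLike.norm_conj, ← h1]
      exact norm_ne_zero_iff.2 (hden s)
    rw [norm_mul, norm_div, h1, RCLike.norm_conj, div_self h2, mul_one]
  · intro hcon
    rw [mul_eq_left₀ hx₀, div_eq_one_iff_eq (hden s)] at hcon
    have h1 := congrArg Complex.im hcon
    simp at h1
    apply hs
    simp only [mem_singleton_iff]
    linarith

/-- If `1 + 2 x W x` has nonnegative real part on a circle, then it has so inside, and the
Schwarz lemma holds for `x W x / (1 + x W x)`. -/
theorem re_nonneg_and_norm_le {W : ℂ → ℂ} (hW : DifferentiableOn ℂ W (ball 0 1)) {x₀ : ℂ}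
    (hx₀ : x₀ ≠ 0) (hx₀1 : ‖x₀‖ < 1)
    (h : ∀ x, ‖x‖ = ‖x₀‖ → x ≠ x₀ → 0 ≤ (1 + 2 * (x * W x)).re) {x : ℂ} (hx : ‖x‖ ≤ ‖x₀‖) :
    0 ≤ (1 + 2 * (x * W x)).re ∧ ‖W x / (1 + x * W x)‖ ≤ 1 / ‖x₀‖ := by
  have hρ : 0 < ‖x₀‖ := norm_pos_iff.2 hx₀
  have hsub : closure (ball (0 : ℂ) ‖x₀‖) ⊆ ball 0 1 := by
    rw [closure_ball _ hρ.ne']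
    exact closedBall_subset_ball hx₀1
  have hcl : ∀ y : ℂ, ‖y‖ ≤ ‖x₀‖ → y ∈ closure (ball (0 : ℂ) ‖x₀‖) := by
    intro y hy
    rw [closure_ball _ hρ.ne']
    simpa using hy
  have hfr : ∀ y ∈ frontier (ball (0 : ℂ) ‖x₀‖), ‖y‖ = ‖x₀‖ := by
    intro y hy
    rw [frontier_ball _ hρ.ne'] at hy
    simpa using hy
  have hQ : DifferentiableOn ℂ (fun x => 1 + 2 * (x * W x)) (ball 0 1) :=
    (differentiableOn_const _).add ((differentiableOn_const _).mul (differentiableOn_id.mul hW))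
  have hcirc : ∀ y, ‖y‖ = ‖x₀‖ → 0 ≤ (1 + 2 * (y * W y)).re := by
    intro y hy
    by_cases hyx : y = x₀
    · subst hyx
      exact re_nonneg_of_forall_ne (g := fun x => 1 + 2 * (x * W x)) hx₀
        (hQ.differentiableAt (isOpen_ball.mem_nhds (by simpa using hx₀1))).continuousAt h
    · exact h y hy hyx
  have hre : ∀ y, ‖y‖ ≤ ‖x₀‖ → 0 ≤ (1 + 2 * (y * W y)).re := by
    intro y hy
    -- The minimum principle for a real part is the maximum principle for `exp (-Q)`, whose modulus
    -- is `exp (-Re Q)`.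
    have h1 := Complex.norm_le_of_forall_mem_frontier_norm_le (C := 1)
      (f := fun x => Complex.exp (-(1 + 2 * (x * W x)))) isBounded_ball
      (DifferentiableOn.diffContOnCl (hQ.neg.cexp.mono hsub)) (fun w hw => by
        rw [Complex.norm_exp, Real.exp_le_one_iff, Complex.neg_re]
        linarith [hcirc w (hfr w hw)]) (hcl y hy)
    rw [Complex.norm_exp, Real.exp_le_one_iff, Complex.neg_re] at h1
    linarith
  refine ⟨hre x hx, ?_⟩
  refine Complex.norm_le_of_forall_mem_frontier_norm_le (C := 1 / ‖x₀‖)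
      (f := fun x => W x / (1 + x * W x)) isBounded_ball
      (DifferentiableOn.diffContOnCl ?_) (fun w hw => ?_) (hcl x hx)
  · refine (hW.mono hsub).div
      ((differentiableOn_const _).add (differentiableOn_id.mul (hW.mono hsub))) fun y hy => ?_
    rw [closure_ball _ hρ.ne'] at hy
    exact one_add_ne_zero_of_re_nonneg (hre y (by simpa using hy))
  · have h1 := norm_div_one_add_le_one (hcirc w (hfr w hw))
    rw [mul_div_assoc, norm_mul, hfr w hw] at h1
    rw [le_div_iff₀ hρ]
    linarith

theorem dslope_comm (E : ℂ → ℂ) (a b : ℂ) : dslope E a b = dslope E b a := by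
  by_cases h : a = b
  · rw [h]
  · rw [dslope_of_ne _ (Ne.symm h), dslope_of_ne _ h, slope_comm]

/-! ### The two-point inequality and the representation formula -/

namespace ConcaveAtZero

variable {E : ℂ → ℂ} (hE : ConcaveAtZero E)
include hE

theorem hasDerivAt_div {z : ℂ} (hz : ‖z‖ < 1) (hz0 : z ≠ 0) :
    HasDerivAt (fun z => E z / z) ((deriv E z * z - E z) / z ^ 2) z := by
  have h := (hE.diff.differentiableAt (isOpen_ball.mem_nhds (by simpa using hz))).hasDerivAt.div
    (hasDerivAt_id z) hz0
  exact h.congr_deriv (by simp)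

theorem deriv_mul_sub_ne_zero {z : ℂ} (hz : ‖z‖ < 1) : deriv E z * z - E z ≠ 0 := by
  by_cases hz0 : z = 0
  · simpa [hz0] using hE.ne_zero
  obtain ⟨k, hk⟩ := exists_analyticAt_leftInverse isOpen_puncturedDisc hE.diff_div hE.inj
  have := (hk z (mem_puncturedDisc.2 ⟨hz, hz0⟩)).2.2
  rw [(hE.hasDerivAt_div hz hz0).deriv] at this
  intro h
  simp [h] at this

/-- By `norm_le_of_combo_eq`, the preimage of the segment from `F z` to `F x` starts at `z` and does
not enter `|y| < |z|`. The derivative of its squared modulus at the start is therefore nonnegative.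
-/
theorem re_nonneg_of_norm_eq {z x : ℂ} (hz : ‖z‖ < 1) (hz0 : z ≠ 0) (hx : ‖x‖ = ‖z‖) :
    0 ≤ ((E x / x - E z / z) / (z * ((deriv E z * z - E z) / z ^ 2))).re := by
  set F : ℂ → ℂ := fun z => E z / z with hF
  set F' := (deriv E z * z - E z) / z ^ 2 with hF'
  have hzD : z ∈ ball (0 : ℂ) 1 \ {0} := mem_puncturedDisc.2 ⟨hz, hz0⟩
  have hFd : HasDerivAt F F' z := hE.hasDerivAt_div hz hz0
  have hF'0 : F' ≠ 0 := div_ne_zero (hE.deriv_mul_sub_ne_zero hz) (pow_ne_zero _ hz0)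
  obtain ⟨k, hk⟩ := exists_analyticAt_leftInverse isOpen_puncturedDisc hE.diff_div hE.inj
  obtain ⟨hkz, hka, -⟩ := hk z hzD
  have hkd : HasDerivAt k F'⁻¹ (F z) := by
    have h1 : HasDerivAt (k ∘ F) (deriv k (F z) * F') z :=
      HasDerivAt.comp z (h₂ := k) (h := F) hka.differentiableAt.hasDerivAt hFd
    have h2 : HasDerivAt (k ∘ F) 1 z :=
      (hasDerivAt_id z).congr_of_eventuallyEq <| by
        filter_upwards [isOpen_puncturedDisc.eventually_mem hzD] with w hw using (hk w hw).1
    have h3 := h1.unique h2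
    rw [← eq_inv_of_mul_eq_one_left h3]
    exact hka.differentiableAt.hasDerivAt
  set v := F x - F z with hv
  have hγ : HasDerivAt (fun t : ℝ => k (F z + t * v) / z) (F'⁻¹ * v / z) 0 := by
    have h1 : HasDerivAt (fun t : ℝ => F z + t * v) v 0 := by
      simpa using ((Complex.ofRealCLM.hasDerivAt (x := (0 : ℝ))).mul_const v).const_add (F z)
    have h2 : HasDerivAt k F'⁻¹ ((fun t : ℝ => F z + t * v) 0) := by simpa using hkd
    exact (h2.comp (0 : ℝ) h1).div_const z
  have hsq := hγ.norm_sq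
  have h0 : k (F z) / z = 1 := by rw [show k (F z) = z from hkz, div_self hz0]
  have hsl := hsq.tendsto_slope_zero_right
  have hlim : 0 ≤ 2 * inner ℝ (k (F z + ((0 : ℝ) : ℂ) * v) / z) (F'⁻¹ * v / z) := by
    refine ge_of_tendsto hsl ?_
    have hopen : ∀ᶠ t : ℝ in 𝓝[>] 0, F z + t * v ∈ F '' (ball (0 : ℂ) 1 \ {0}) := by
      have h1 : Tendsto (fun t : ℝ => F z + t * v) (𝓝[>] 0) (𝓝 (F z)) := by
        have : ContinuousAt (fun t : ℝ => F z + t * v) 0 := by fun_prop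
        simpa using this.tendsto.mono_left nhdsWithin_le_nhds
      exact h1 (nhds_le_map_of_injOn isOpen_puncturedDisc hE.diff_div hE.inj hzD
        (image_mem_map (isOpen_puncturedDisc.mem_nhds hzD)))
    have hle1 : ∀ᶠ t : ℝ in 𝓝[>] 0, t < 1 :=
      (gt_mem_nhds one_pos : ∀ᶠ t : ℝ in 𝓝 0, t < 1).filter_mono nhdsWithin_le_nhds
    filter_upwards [hopen, hle1, self_mem_nhdsWithin] with t ⟨y, hy, hyt⟩ ht1 ht0
    have ht0' : 0 < t := ht0
    have hy' := mem_puncturedDisc.1 hy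
    -- The rotations are `μ = 1` and `ν = x / z`, the latter unimodular because `|x| = |z|`.
    have hle : ‖z‖ ≤ ‖y‖ := by
      refine hE.norm_le_of_combo_eq (s := 1 - t) (t := t) (by linarith) ht0'.le (by ring)
        (μ := 1) (ν := x / z) (by simp) (by rw [norm_div, hx, div_self (norm_ne_zero_iff.2 hz0)])
        hz hz0 hy'.1 hy'.2 ?_
      rw [one_mul, div_mul_cancel₀ _ hz0]
      have : F y = F z + t * (F x - F z) := hyt
      simp only [hF] at this
      rw [this]
      push_cast
      ring
    have hky : k (F z + t * v) = y := by rw [← hyt]; exact (hk y hy).1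
    have h1 : 1 ≤ ‖y / z‖ := by
      rw [norm_div, one_le_div (norm_pos_iff.2 hz0)]
      exact hle
    simp only [zero_add, hky, Complex.ofReal_zero, zero_mul, add_zero, h0, norm_one, smul_eq_mul]
    have : 1 ≤ ‖y / z‖ ^ 2 := one_le_pow₀ h1
    have := inv_pos.2 ht0'
    nlinarith
  simp only [Complex.ofReal_zero, zero_mul, add_zero, h0, Complex.inner, map_one, mul_one]
    at hlim
  have : v / (z * F') = F'⁻¹ * v / z := by field_simp
  change 0 ≤ (v / (z * F')).re
  rw [this]
  linarith

/-- Away from the pole the expression is `z x (F z - F x) / (x - z)`, with diagonal value `-z² F'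
z`; both are nonzero because `F` is injective. -/
theorem sub_mul_dslope_ne_zero {z x : ℂ} (hz : ‖z‖ < 1) (hx : ‖x‖ < 1) :
    E z - z * dslope E z x ≠ 0 := by
  by_cases hxz : x = z
  · subst hxz
    rw [dslope_same]
    intro h
    exact hE.deriv_mul_sub_ne_zero hx (by linear_combination -h)
  · rw [dslope_of_ne _ hxz, slope_def_field]
    have hsub : x - z ≠ 0 := sub_ne_zero.2 hxz
    intro h
    have h1 : x * E z = z * E x := by
      field_simp at h
      linear_combination h
    by_cases hz0 : z = 0
    · simp [hz0] at h1
      exact h1.elim (fun h => hxz (h.trans hz0.symm)) hE.ne_zero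
    by_cases hx0 : x = 0
    · simp [hx0] at h1
      exact h1.elim hz0 hE.ne_zero
    refine hxz (hE.inj (mem_puncturedDisc.2 ⟨hx, hx0⟩) (mem_puncturedDisc.2 ⟨hz, hz0⟩) ?_)
    simp only
    field_simp
    linear_combination -h1

/-- The two-point inequality on the torus `‖z‖ = ‖x‖`. -/
theorem re_one_add_nonneg {z x : ℂ} (hz : ‖z‖ < 1) (hz0 : z ≠ 0) (hx : ‖x‖ = ‖z‖) (hxz : x ≠ z) :
    0 ≤ (1 + 2 * (z * x * ((deriv E z - dslope E z x) / (z - x) /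
      (E z - z * dslope E z x)))).re := by
  have hx0 : x ≠ 0 := norm_ne_zero_iff.1 (hx ▸ norm_ne_zero_iff.2 hz0)
  have hx1 : ‖x‖ < 1 := hx ▸ hz
  have hsub : z - x ≠ 0 := sub_ne_zero.2 hxz.symm
  have hsub' : x - z ≠ 0 := sub_ne_zero.2 hxz
  have hA := hE.re_nonneg_of_norm_eq hz hz0 hx
  have hden := hE.sub_mul_dslope_ne_zero hz hx1
  rw [dslope_of_ne _ hxz, slope_def_field] at hden ⊢
  have hden' : x * E z - z * E x ≠ 0 := by
    intro h
    apply hden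
    field_simp
    linear_combination h
  have hd := hE.deriv_mul_sub_ne_zero hz
  have hinv : 0 ≤ ((z * ((deriv E z * z - E z) / z ^ 2)) / (E x / x - E z / z)).re := by
    rw [← inv_div, Complex.inv_re]
    exact div_nonneg hA (Complex.normSq_nonneg _)
  -- On `|x| = |z|` this summand costs nothing, and in `key` it cancels the pole of `2 z F' z / (F x
  -- - F z)` at `x = z`.
  have hcay : ((z + x) / (z - x)).re = 0 := by
    rw [Complex.div_re]
    have h1 : Complex.normSq x = Complex.normSq z := by
      rw [Complex.normSq_eq_norm_sq, Complex.normSq_eq_norm_sq, hx]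
    rw [Complex.normSq_apply, Complex.normSq_apply] at h1
    rw [← add_div]
    simp only [Complex.add_re, Complex.sub_re, Complex.add_im, Complex.sub_im]
    rw [div_eq_zero_iff]
    left
    linear_combination -h1
  have key : 1 + 2 * (z * x * ((deriv E z - (E x - E z) / (x - z)) / (z - x) /
      (E z - z * ((E x - E z) / (x - z))))) =
      2 * ((z * ((deriv E z * z - E z) / z ^ 2)) / (E x / x - E z / z)) + (z + x) / (z - x) := by
    have e1 : E z - z * ((E x - E z) / (x - z)) = (x * E z - z * E x) / (x - z) := by
      field_simp
      ring
    have e2 : E x / x - E z / z = -(x * E z - z * E x) / (z * x) := by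
      field_simp
      ring
    have e3 : z - x = -(x - z) := by ring
    rw [e1, e2, e3]
    field_simp
    ring
  rw [key, Complex.add_re, hcay]
  simp only [Complex.mul_re, Complex.re_ofNat, Complex.im_ofNat]
  linarith

/-- The two-point inequality on the bidisc, with one point `a` fixed. -/
theorem exists_two_point_function {a : ℂ} (ha : ‖a‖ < 1) (ha0 : a ≠ 0) :
    ∃ H : ℂ → ℂ, DifferentiableOn ℂ H (ball 0 1) ∧ (∀ x, ‖x‖ < 1 → ‖H x‖ ≤ 1) ∧
      ∀ x, ‖x‖ < 1 → x ≠ a →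
        H x * (E a - a * dslope E a x + a * x * ((deriv E a - dslope E a x) / (a - x))) =
          (deriv E a - dslope E a x) / (a - x) := by
  have hnhds : ∀ {x : ℂ}, ‖x‖ < 1 → ball (0 : ℂ) 1 ∈ 𝓝 x := fun hx =>
    isOpen_ball.mem_nhds (by simpa using hx)
  have hslope : ∀ {b : ℂ}, ‖b‖ < 1 → DifferentiableOn ℂ (dslope E b) (ball 0 1) := fun hb =>
    (Complex.differentiableOn_dslope (hnhds hb)).2 hE.diff
  -- the quotient as a function of the second point
  set W : ℂ → ℂ := fun x => dslope (dslope E a) a x / (E a - a * dslope E a x) with hW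
  have hWd : DifferentiableOn ℂ W (ball 0 1) :=
    ((Complex.differentiableOn_dslope (hnhds ha)).2 (hslope ha)).div
      ((differentiableOn_const _).sub ((differentiableOn_const _).mul (hslope ha)))
      fun x hx => hE.sub_mul_dslope_ne_zero ha (by simpa using hx)
  have hWeq : ∀ x, x ≠ a → W x = (deriv E a - dslope E a x) / (a - x) /
      (E a - a * dslope E a x) := by
    intro x hx
    rw [hW]
    simp only
    rw [dslope_of_ne (dslope E a) hx, slope_def_field, dslope_same]
    congr 1
    rw [← neg_div_neg_eq, neg_sub, neg_sub]
  -- the quotient as a function of the first point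
  have hfirst : ∀ x : ℂ, ‖x‖ < 1 → x ≠ 0 → x ≠ a → ‖a‖ ≤ ‖x‖ →
      0 ≤ (1 + 2 * (a * x * W x)).re ∧ ‖x * W x / (1 + a * x * W x)‖ ≤ 1 / ‖x‖ := by
    intro x hx hx0 hxa hax
    -- Here `x` is frozen and `z` varies in the disc `|z| ≤ |x|`, on whose boundary the torus
    -- inequality holds; evaluation at `z = a` is allowed because `|a| ≤ |x|`.
    set V : ℂ → ℂ := fun z => x * (dslope (fun z => deriv E z - dslope E x z) x z /
      (E z - z * dslope E x z)) with hV
    have hVd : DifferentiableOn ℂ V (ball 0 1) := by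
      refine (differentiableOn_const _).mul (DifferentiableOn.div ?_
        (hE.diff.sub (differentiableOn_id.mul (hslope hx))) fun z hz => ?_)
      · exact (Complex.differentiableOn_dslope (hnhds hx)).2
          ((hE.diff.deriv isOpen_ball).sub (hslope hx))
      · rw [dslope_comm]
        exact hE.sub_mul_dslope_ne_zero (by simpa using hz) hx
    have hVeq : ∀ z, z ≠ x → V z = x * ((deriv E z - dslope E z x) / (z - x) /
        (E z - z * dslope E z x)) := by
      intro z hz
      rw [hV]
      simp only
      rw [dslope_of_ne _ hz, slope_def_field, dslope_same, sub_self, sub_zero, dslope_comm E x z]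
    have hVa : V a = x * W x := by rw [hVeq a hxa.symm, hWeq x hxa]
    have h1 := re_nonneg_and_norm_le hVd hx0 hx (fun z hz hzx => by
      have hz0 : z ≠ 0 := norm_ne_zero_iff.1 (hz ▸ norm_ne_zero_iff.2 hx0)
      have := hE.re_one_add_nonneg (hz ▸ hx) hz0 hz.symm hzx.symm
      rw [hVeq z hzx, ← mul_assoc z x]
      exact this) hax
    rw [hVa] at h1
    rw [mul_assoc]
    exact h1
  have hre : ∀ x, ‖x‖ < 1 → 0 ≤ (1 + 2 * (a * x * W x)).re := by
    intro x hx
    -- Now the second variable moves: on a circle of radius `ρ > |a|` the inequality is `hfirst`,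
    -- and the maximum principle carries it inside.
    obtain ⟨ρ, hρ, hρ1⟩ := exists_between (max_lt hx ha)
    obtain ⟨hxρ, haρ⟩ := max_lt_iff.1 hρ
    have hρ0 : 0 < ρ := (norm_nonneg a).trans_lt haρ
    have hn : ‖(ρ : ℂ)‖ = ρ := by simp [abs_of_pos hρ0]
    have h1 := (re_nonneg_and_norm_le (W := fun x => a * W x) (hWd.const_mul a)
      (x₀ := (ρ : ℂ)) (by exact_mod_cast hρ0.ne') (by rwa [hn]) (fun z hz _ => by
        rw [hn] at hz
        have hz0 : z ≠ 0 := by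
          rintro rfl
          simp at hz
          linarith
        have hza : z ≠ a := by
          rintro rfl
          linarith
        have := (hfirst z (by rwa [hz]) hz0 hza (by rw [hz]; exact haρ.le)).1
        rwa [← mul_assoc z a, mul_comm z a]) (x := x) (by rw [hn]; exact hxρ.le)).1
    rwa [← mul_assoc x a, mul_comm x a] at h1
  have hne : ∀ x, ‖x‖ < 1 → 1 + a * x * W x ≠ 0 := fun x hx =>
    one_add_ne_zero_of_re_nonneg (hre x hx)
  set H : ℂ → ℂ := fun x => W x / (1 + a * x * W x) with hH
  have hHd : DifferentiableOn ℂ H (ball 0 1) :=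
    hWd.div ((differentiableOn_const _).add
      (((differentiableOn_const _).mul differentiableOn_id).mul hWd))
      fun x hx => hne x (by simpa using hx)
  refine ⟨H, hHd, fun x hx => ?_, fun x hx hxa => ?_⟩
  -- One factor `1 / ρ` comes from `hfirst` and the other from dividing by the `x` in its numerator;
  -- then `ρ → 1`.
  · have hbound : ∀ ρ : ℝ, max ‖x‖ ‖a‖ < ρ → ρ < 1 → ‖H x‖ ≤ 1 / ρ ^ 2 := by
      intro ρ hρ hρ1
      obtain ⟨hxρ, haρ⟩ := max_lt_iff.1 hρ
      have hρ0 : 0 < ρ := (norm_nonneg a).trans_lt haρ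
      refine Complex.norm_le_of_forall_mem_frontier_norm_le (U := ball (0 : ℂ) ρ) isBounded_ball
        (DifferentiableOn.diffContOnCl (hHd.mono ?_)) (fun z hz => ?_)
        (subset_closure (by simpa using hxρ))
      · rw [closure_ball _ hρ0.ne']
        exact closedBall_subset_ball hρ1
      · rw [frontier_ball _ hρ0.ne'] at hz
        have hz : ‖z‖ = ρ := by simpa using hz
        have hz0 : z ≠ 0 := by
          rintro rfl
          simp at hz
          linarith
        have hza : z ≠ a := by
          rintro rfl
          linarith
        have := (hfirst z (by rwa [hz]) hz0 hza (by rw [hz]; exact haρ.le)).2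
        rw [mul_div_assoc, norm_mul, hz, le_div_iff₀ hρ0] at this
        rw [le_div_iff₀ (by positivity)]
        change ‖W z / (1 + a * z * W z)‖ * ρ ^ 2 ≤ 1
        linarith
    have hlim : Tendsto (fun ρ : ℝ => 1 / ρ ^ 2) (𝓝[<] 1) (𝓝 1) := by
      have : ContinuousAt (fun ρ : ℝ => 1 / ρ ^ 2) 1 :=
        continuousAt_const.div (by fun_prop) (by norm_num)
      simpa using this.tendsto.mono_left nhdsWithin_le_nhds
    refine ge_of_tendsto hlim ?_
    have h1 : ∀ᶠ ρ : ℝ in 𝓝[<] 1, max ‖x‖ ‖a‖ < ρ :=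
      (lt_mem_nhds (max_lt hx ha) : ∀ᶠ ρ : ℝ in 𝓝 1, _ < ρ).filter_mono nhdsWithin_le_nhds
    filter_upwards [h1, self_mem_nhdsWithin] with ρ h2 h3 using hbound ρ h2 h3
  · have h1 := hne x hx
    have h2 := hE.sub_mul_dslope_ne_zero ha hx
    have h3 := hWeq x hxa
    have h4 : (deriv E a - dslope E a x) / (a - x) = W x * (E a - a * dslope E a x) := by
      rw [h3, div_mul_cancel₀ _ h2]
    rw [h4, hH]
    simp only
    rw [div_mul_eq_mul_div, div_eq_iff h1]
    ring

/-- The representation of a concave function with pole `0` that vanishes at `-p`. -/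
theorem exists_representation {p : ℝ} (hp : 0 < p) (hp1 : p < 1) (h0 : E (-p) = 0)
    (hd : deriv E (-p) = -p / (1 - p ^ 2)) :
    ∃ Ω : ℂ → ℂ, DifferentiableOn ℂ Ω (ball 0 1) ∧ (∀ x, ‖x‖ < 1 → ‖Ω x‖ ≤ 1) ∧
      ∀ x, ‖x‖ < 1 → E x =
        -p * (x + p) * (1 + p ^ 3 * x - p * Ω x * (p + x)) / ((1 - p ^ 2) * (1 - p ^ 4)) := by
  have hpn : ‖(-p : ℂ)‖ = p := by simp [abs_of_pos hp]
  have hp0 : (p : ℂ) ≠ 0 := by exact_mod_cast hp.ne'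
  have hp2 : (1 - p ^ 2 : ℂ) ≠ 0 := by
    have : (1 - p ^ 2 : ℝ) ≠ 0 := by nlinarith
    exact_mod_cast this
  have hp4 : (1 - p ^ 4 : ℂ) ≠ 0 := by
    have : (1 - p ^ 4 : ℝ) ≠ 0 := by
      have : p ^ 4 < 1 := pow_lt_one₀ hp.le hp1 (by norm_num)
      linarith
    exact_mod_cast this
  obtain ⟨H, hHd, hHn, hHeq⟩ := hE.exists_two_point_function (a := -p) (by rwa [hpn])
    (neg_ne_zero.2 hp0)
  have hp2lt : p ^ 2 < 1 := by nlinarith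
  have hden : ∀ x : ℂ, ‖x‖ < 1 → 1 - p ^ 2 * H x ≠ 0 := by
    intro x hx h
    have h1 : (p : ℂ) ^ 2 * H x = 1 := by linear_combination -h
    have h2 := congrArg norm h1
    rw [norm_mul, norm_pow, Complex.norm_real, Real.norm_of_nonneg hp.le, norm_one] at h2
    nlinarith [hHn x hx, norm_nonneg (H x)]
  -- The equation for `E` is fractional linear in `H`, with denominator `1 - p² H`. This involution
  -- of the disc makes it affine in `Ω`.
  refine ⟨fun x => (p ^ 2 - H x) / (1 - p ^ 2 * H x), ?_, fun x hx => ?_, fun x hx => ?_⟩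
  · exact ((differentiableOn_const _).sub hHd).div
      ((differentiableOn_const _).sub (hHd.const_mul _)) fun x hx => hden x (by simpa using hx)
  · rw [norm_div]
    refine div_le_one_of_le₀ ?_ (norm_nonneg _)
    rw [← sq_le_sq₀ (norm_nonneg _) (norm_nonneg _), Complex.sq_norm, Complex.sq_norm]
    have h1 : Complex.normSq (H x) ≤ 1 := by
      rw [Complex.normSq_eq_norm_sq]
      exact pow_le_one₀ (norm_nonneg _) (hHn x hx)
    rw [Complex.normSq_apply] at h1 ⊢
    rw [Complex.normSq_apply]
    have e : (p : ℂ) ^ 2 = ((p ^ 2 : ℝ) : ℂ) := by push_cast; ring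
    rw [e]
    simp only [Complex.sub_re, Complex.sub_im, Complex.ofReal_re, Complex.ofReal_im,
      Complex.one_re, Complex.one_im, Complex.re_ofReal_mul, Complex.im_ofReal_mul]
    have h2 : (p ^ 2) ^ 2 ≤ 1 := pow_le_one₀ (by positivity) hp2lt.le
    nlinarith
  · have hΩ := hden x hx
    by_cases hxp : x = -p
    · rw [hxp, h0]
      simp
    have hxp' : x + p ≠ 0 := fun h => hxp (by linear_combination h)
    have hxp'' : -p - x ≠ 0 := fun h => hxp (by linear_combination -h)
    have h1 := hHeq x hx hxp
    rw [dslope_of_ne _ hxp, slope_def_field, h0, hd, sub_zero, sub_neg_eq_add] at h1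
    have e : (-p - x : ℂ) = -(x + p) := by ring
    rw [e] at h1
    have h2 : E x * (1 - p ^ 2) * (1 - p ^ 2 * H x) = -p * (x + p) * (1 + p * x * H x) := by
      field_simp at h1
      linear_combination -h1
    field_simp
    linear_combination (1 - p ^ 4) * h2

end ConcaveAtZero

/-! ### Disc automorphisms exchanging the pole and the origin -/

theorem one_sub_mul_ne_zero {p : ℝ} (hp : 0 < p) (hp1 : p < 1) {z : ℂ} (hz : ‖z‖ < 1) :
    1 - p * z ≠ 0 := by
  intro h
  have h1 : (p : ℂ) * z = 1 := by linear_combination -h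
  have h2 := congrArg norm h1
  rw [norm_mul, Complex.norm_real, Real.norm_of_nonneg hp.le, norm_one] at h2
  nlinarith [norm_nonneg z]

theorem one_add_mul_ne_zero {p : ℝ} (hp : 0 < p) (hp1 : p < 1) {z : ℂ} (hz : ‖z‖ < 1) :
    1 + p * z ≠ 0 := by
  simpa using one_sub_mul_ne_zero hp hp1 (z := -z) (by simpa using hz)

theorem ofReal_ne_zero_of_pos {p : ℝ} (hp : 0 < p) : (p : ℂ) ≠ 0 := by exact_mod_cast hp.ne'

theorem one_sub_sq_ne_zero {p : ℝ} (hp : 0 < p) (hp1 : p < 1) : (1 - p ^ 2 : ℂ) ≠ 0 := by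
  have : (1 - p ^ 2 : ℝ) ≠ 0 := by nlinarith
  exact_mod_cast this

theorem one_add_sq_ne_zero (p : ℝ) : (1 + p ^ 2 : ℂ) ≠ 0 := by
  have : (1 + p ^ 2 : ℝ) ≠ 0 := by positivity
  exact_mod_cast this

theorem norm_sub_lt_norm_one_sub {p : ℝ} (hp : 0 < p) (hp1 : p < 1) {z : ℂ} (hz : ‖z‖ < 1) :
    ‖z - p‖ < ‖1 - p * z‖ := by
  rw [← sq_lt_sq₀ (norm_nonneg _) (norm_nonneg _), Complex.sq_norm, Complex.sq_norm,
    Complex.normSq_apply, Complex.normSq_apply]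
  have h1 : Complex.normSq z < 1 := by
    rw [Complex.normSq_eq_norm_sq]
    exact pow_lt_one₀ (norm_nonneg _) hz (by norm_num)
  rw [Complex.normSq_apply] at h1
  simp only [Complex.sub_re, Complex.sub_im, Complex.ofReal_re, Complex.ofReal_im,
    Complex.one_re, Complex.one_im, Complex.re_ofReal_mul, Complex.im_ofReal_mul]
  have : p ^ 2 < 1 := by nlinarith
  nlinarith

/-- The automorphism of the disc that takes `p` to `0`. -/
def toZero (p : ℝ) (z : ℂ) : ℂ := (z - p) / (1 - p * z)

/-- The automorphism of the disc that takes `0` to `p`. -/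
def ofZero (p : ℝ) (z : ℂ) : ℂ := (z + p) / (1 + p * z)

theorem ofZero_eq (p : ℝ) (z : ℂ) : ofZero p z = -toZero p (-z) := by
  rw [ofZero, toZero, ← neg_div]
  congr 1 <;> ring

section Moebius

variable {p : ℝ} (hp : 0 < p) (hp1 : p < 1)
include hp hp1

theorem norm_toZero_lt {z : ℂ} (hz : ‖z‖ < 1) : ‖toZero p z‖ < 1 := by
  rw [toZero, norm_div, div_lt_one (norm_pos_iff.2 (one_sub_mul_ne_zero hp hp1 hz))]
  exact norm_sub_lt_norm_one_sub hp hp1 hz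

theorem norm_ofZero_lt {z : ℂ} (hz : ‖z‖ < 1) : ‖ofZero p z‖ < 1 := by
  rw [ofZero_eq, norm_neg]
  exact norm_toZero_lt hp hp1 (by simpa using hz)

theorem ofZero_toZero {z : ℂ} (hz : ‖z‖ < 1) : ofZero p (toZero p z) = z := by
  have h1 := one_sub_mul_ne_zero hp hp1 hz
  have h2 := one_add_mul_ne_zero hp hp1 (norm_toZero_lt hp hp1 hz)
  have h3 : 1 - z * p ≠ 0 := by rwa [mul_comm]
  rw [ofZero, div_eq_iff h2, toZero]
  field_simp
  ring

theorem toZero_ofZero {z : ℂ} (hz : ‖z‖ < 1) : toZero p (ofZero p z) = z := by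
  have h1 := one_add_mul_ne_zero hp hp1 hz
  have h2 := one_sub_mul_ne_zero hp hp1 (norm_ofZero_lt hp hp1 hz)
  have h3 : 1 + z * p ≠ 0 := by rwa [mul_comm]
  rw [toZero, div_eq_iff h2, ofZero]
  field_simp
  ring

theorem hasDerivAt_ofZero {z : ℂ} (hz : ‖z‖ < 1) :
    HasDerivAt (ofZero p) ((1 - p ^ 2) / (1 + p * z) ^ 2) z := by
  have h1 := one_add_mul_ne_zero hp hp1 hz
  have h := ((hasDerivAt_id z).add_const (p : ℂ)).div
    (((hasDerivAt_id z).const_mul (p : ℂ)).const_add 1) h1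
  refine h.congr_deriv ?_
  simp only [id]
  ring

theorem hasDerivAt_toZero {z : ℂ} (hz : ‖z‖ < 1) :
    HasDerivAt (toZero p) ((1 - p ^ 2) / (1 - p * z) ^ 2) z := by
  have h1 := one_sub_mul_ne_zero hp hp1 hz
  have h := ((hasDerivAt_id z).sub_const (p : ℂ)).div
    (((hasDerivAt_id z).const_mul (p : ℂ)).const_sub 1) h1
  refine h.congr_deriv ?_
  simp only [id]
  ring

theorem toZero_eq_zero_iff {z : ℂ} (hz : ‖z‖ < 1) : toZero p z = 0 ↔ z = p := by
  rw [toZero, div_eq_zero_iff, sub_eq_zero]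
  simp [one_sub_mul_ne_zero hp hp1 hz]

theorem ofZero_eq_iff {z : ℂ} (hz : ‖z‖ < 1) : ofZero p z = p ↔ z = 0 := by
  rw [← toZero_eq_zero_iff hp hp1 (norm_ofZero_lt hp hp1 hz), toZero_ofZero hp hp1 hz]

end Moebius

/-! ### Maximum modulus and Schwarz–Pick -/

theorem eq_of_norm_eq_one {Ω : ℂ → ℂ} (hΩ : DifferentiableOn ℂ Ω (ball 0 1))
    (h1 : ∀ x, ‖x‖ < 1 → ‖Ω x‖ ≤ 1) {x y : ℂ} (hx : ‖x‖ < 1) (hy : ‖y‖ < 1) (hxΩ : ‖Ω x‖ = 1) :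
    Ω y = Ω x :=
  Complex.eqOn_of_isPreconnected_of_isMaxOn_norm (convex_ball (0 : ℂ) 1).isPreconnected isOpen_ball
    hΩ (by simpa using hx) (fun z hz => by
      simpa [hxΩ] using h1 z (by simpa using hz)) (by simpa using hy)

/-- The Schwarz–Pick inequality at the origin. -/
theorem norm_deriv_le_one_sub_sq {Ω : ℂ → ℂ} (hΩ : DifferentiableOn ℂ Ω (ball 0 1))
    (h1 : ∀ x, ‖x‖ < 1 → ‖Ω x‖ ≤ 1) : ‖deriv Ω 0‖ ≤ 1 - ‖Ω 0‖ ^ 2 := by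
  have h00 : ‖(0 : ℂ)‖ < 1 := by simp
  rcases (h1 0 h00).lt_or_eq with hlt | heq
  · have hlt' : ∀ x, ‖x‖ < 1 → ‖Ω x‖ < 1 := by
      intro x hx
      refine (h1 x hx).lt_of_ne fun h => ?_
      rw [eq_of_norm_eq_one hΩ h1 hx h00 h] at hlt
      exact hlt.ne h
    set a := Ω 0 with ha
    have hden : ∀ w : ℂ, ‖w‖ ≤ 1 → 1 - (starRingEnd ℂ) a * w ≠ 0 := by
      intro w hw h
      have h2 := congrArg norm (show (starRingEnd ℂ) a * w = 1 by linear_combination -h)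
      rw [norm_mul, RCLike.norm_conj, norm_one] at h2
      nlinarith [norm_nonneg w, norm_nonneg a]
    have hsq : (1 - ‖a‖ ^ 2 : ℝ) > 0 := by nlinarith [norm_nonneg a]
    -- Composition with the automorphism taking `Ω 0` to `0` reduces the inequality to the Schwarz
    -- lemma.
    set g : ℂ → ℂ := fun x => (Ω x - a) / (1 - (starRingEnd ℂ) a * Ω x) with hg
    have hgd : DifferentiableOn ℂ g (ball 0 1) :=
      (hΩ.sub_const a).div ((differentiableOn_const _).sub (hΩ.const_mul _))
        fun x hx => hden _ (h1 x (by simpa using hx))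
    have hg0 : g 0 = 0 := by simp [hg, ← ha]
    have hmaps : MapsTo g (ball 0 1) (ball (g 0) 1) := by
      intro x hx
      have hx' : ‖x‖ < 1 := by simpa using hx
      rw [hg0, mem_ball_zero_iff, hg]
      simp only
      rw [norm_div, div_lt_one (norm_pos_iff.2 (hden _ (h1 x hx')))]
      rw [← sq_lt_sq₀ (norm_nonneg _) (norm_nonneg _), Complex.sq_norm, Complex.sq_norm]
      have e1 : Complex.normSq a < 1 := by
        rw [Complex.normSq_eq_norm_sq]; linarith
      have e2 : Complex.normSq (Ω x) < 1 := by
        rw [Complex.normSq_eq_norm_sq]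
        exact pow_lt_one₀ (norm_nonneg _) (hlt' x hx') (by norm_num)
      rw [Complex.normSq_apply] at e1 e2 ⊢
      rw [Complex.normSq_apply]
      simp only [Complex.sub_re, Complex.sub_im, Complex.one_re, Complex.one_im, Complex.mul_re,
        Complex.mul_im, Complex.conj_re, Complex.conj_im]
      nlinarith [mul_pos (sub_pos.2 e1) (sub_pos.2 e2)]
    have hder : HasDerivAt g (deriv Ω 0 / ((1 - ‖a‖ ^ 2 : ℝ) : ℂ)) 0 := by
      have hΩ0 : HasDerivAt Ω (deriv Ω 0) 0 :=
        (hΩ.differentiableAt (ball_mem_nhds 0 one_pos)).hasDerivAt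
      have h := (hΩ0.sub_const a).div ((hΩ0.const_mul ((starRingEnd ℂ) a)).const_sub 1)
        (hden _ (h1 0 h00))
      have e : (1 - (starRingEnd ℂ) a * a : ℂ) = ((1 - ‖a‖ ^ 2 : ℝ) : ℂ) := by
        rw [Complex.conj_mul']
        push_cast
        ring
      refine h.congr_deriv ?_
      rw [← ha, e]
      have : ((1 - ‖a‖ ^ 2 : ℝ) : ℂ) ≠ 0 := by exact_mod_cast hsq.ne'
      rw [sub_self, zero_mul, sub_zero]
      field_simp
    have := Complex.norm_deriv_le_one_of_mapsTo_ball hgd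
      (hmaps.mono_right ball_subset_closedBall) one_pos
    rw [hder.deriv, norm_div, Complex.norm_real, Real.norm_of_nonneg hsq.le, div_le_one hsq] at this
    exact this
  · have : deriv Ω 0 = 0 := by
      have h2 : Ω =ᶠ[𝓝 0] fun _ => Ω 0 := by
        filter_upwards [ball_mem_nhds (0 : ℂ) one_pos] with x hx
        exact eq_of_norm_eq_one hΩ h1 h00 (by simpa using hx) heq
      rw [h2.deriv_eq]
      simp
    rw [this, heq]
    simp

/-! ### Transfer from `Co p` to a pole at the origin -/

theorem coe_finitePart {f : 𝔻 → OnePoint ℂ} {z : 𝔻} (h : f z ≠ ∞) :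
    (finitePart f z : OnePoint ℂ) = f z := by
  rw [finitePart, dif_pos z.norm_lt_one]
  simp only [Complex.UnitDisc.mk_coe]
  induction hfz : f z using OnePoint.rec with
  | infty => exact absurd hfz h
  | coe w => rfl

theorem finitePart_of_eq_coe {f : 𝔻 → OnePoint ℂ} {z : ℂ} (hz : ‖z‖ < 1) {w : ℂ}
    (h : f (.mk z hz) = w) : finitePart f z = w := by
  rw [finitePart, dif_pos hz, h]
  rfl

namespace IsConcave

variable {p : ℝ} {f : 𝔻 → OnePoint ℂ} (hf : IsConcave p f) (hp : 0 < p) (hp1 : p < 1)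
include hf hp hp1

theorem eq_infty_iff {z : 𝔻} : f z = ∞ ↔ (z : ℂ) = p := by
  have hpn : ‖(p : ℂ)‖ < 1 := by simpa [abs_of_pos hp] using hp1
  have hpinf : f (.mk p hpn) = ∞ := by
    by_contra h
    have h1 := ((hf.meromorphic (.mk p hpn)).1 h).meromorphicOrderAt_nonneg
    rw [Complex.UnitDisc.coe_mk, hf.simple_pole] at h1
    exact absurd h1 (by decide)
  constructor
  · intro h
    rw [← hpinf] at h
    rw [hf.injective h]
    rfl
  · intro h
    have : z = .mk p hpn := Complex.UnitDisc.coe_injective h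
    rw [this, hpinf]

theorem coe_eq {z : ℂ} (hz : ‖z‖ < 1) (hzp : z ≠ p) :
    f (.mk z hz) = (finitePart f z : OnePoint ℂ) := by
  have := coe_finitePart (f := f) (z := .mk z hz)
    (fun h => hzp ((hf.eq_infty_iff hp hp1).1 h))
  simpa using this.symm

theorem analyticAt {z : ℂ} (hz : ‖z‖ < 1) (hzp : z ≠ p) : AnalyticAt ℂ (finitePart f) z :=
  (hf.meromorphic (.mk z hz)).1 fun h => hzp ((hf.eq_infty_iff hp hp1).1 h)

/-- `(z - p) f z` is holomorphic in the disc. -/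
theorem exists_regular : ∃ e : ℂ → ℂ, DifferentiableOn ℂ e (ball 0 1) ∧ e p ≠ 0 ∧
    ∀ z : ℂ, z ≠ p → e z = (z - p) * finitePart f z := by
  have hmer : MeromorphicAt (finitePart f) p :=
    meromorphicAt_of_meromorphicOrderAt_ne_zero (by rw [hf.simple_pole]; decide)
  obtain ⟨g, hg, hg0, hgf⟩ := (meromorphicOrderAt_eq_int_iff (n := -1) hmer).1 hf.simple_pole
  refine ⟨Function.update (fun z => (z - p) * finitePart f z) p (g p), ?_, ?_, ?_⟩
  · intro z hz
    refine DifferentiableAt.differentiableWithinAt ?_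
    by_cases hzp : z = p
    · subst hzp
      refine hg.differentiableAt.congr_of_eventuallyEq ?_
      rw [eventually_nhdsWithin_iff] at hgf
      filter_upwards [hgf] with w hw
      by_cases hwp : w = p
      · simp [hwp]
      · have h1 := hw hwp
        rw [Function.update_of_ne hwp, h1]
        have : w - p ≠ 0 := sub_ne_zero.2 hwp
        simp [field]
    · have h1 : DifferentiableAt ℂ (fun z => (z - p) * finitePart f z) z :=
        (differentiableAt_id.sub_const _).mul
          (hf.analyticAt hp hp1 (by simpa using hz) hzp).differentiableAt
      refine h1.congr_of_eventuallyEq ?_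
      filter_upwards [isOpen_compl_singleton.mem_nhds hzp] with w hw
      rw [Function.update_of_ne hw]
  · simpa using hg0
  · intro z hz
    rw [Function.update_of_ne hz]

/-- Precomposition with `ofZero p` does not change the image, so the omitted set stays convex. The
normalization at `0` becomes data at `-p`, where `ofZero p` vanishes and has derivative `1 / (1 -
p²)`. -/
theorem exists_concaveAtZero : ∃ E : ℂ → ℂ, ConcaveAtZero E ∧ E (-p) = 0 ∧
    deriv E (-p) = -p / (1 - p ^ 2) ∧
    ∀ x, ‖x‖ < 1 → x ≠ 0 → E x / x = finitePart f (ofZero p x) := by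
  obtain ⟨e, hed, hep, he⟩ := hf.exists_regular hp hp1
  have hp0 := ofReal_ne_zero_of_pos hp
  have hp2 := one_sub_sq_ne_zero hp hp1
  have hnp : ‖(-p : ℂ)‖ < 1 := by simpa [abs_of_pos hp] using hp1
  have h00 : ‖(0 : ℂ)‖ < 1 := by simp
  have hf0 : finitePart f 0 = 0 := finitePart_of_eq_coe h00 (by
    rw [show Complex.UnitDisc.mk 0 h00 = 0 from rfl]
    exact hf.map_zero)
  -- This is `x F x` with the pole already removed, because `ofZero p x - p = x (1 - p²) / (1 + p
  -- x)`.
  set E : ℂ → ℂ := fun x => e (ofZero p x) * (1 + p * x) / (1 - p ^ 2) with hE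
  have hEF : ∀ x, ‖x‖ < 1 → x ≠ 0 → E x / x = finitePart f (ofZero p x) := by
    intro x hx hx0
    have h1 := one_add_mul_ne_zero hp hp1 hx
    have h2 : ofZero p x ≠ p := fun h => hx0 ((ofZero_eq_iff hp hp1 hx).1 h)
    have h1' : 1 + x * p ≠ 0 := by rwa [mul_comm]
    have h3 : ofZero p x - p = x * (1 - p ^ 2) / (1 + p * x) := by
      rw [ofZero]
      field_simp
      ring
    rw [hE]
    simp only
    rw [he _ h2, h3]
    field_simp
  have hofz : DifferentiableOn ℂ (ofZero p) (ball 0 1) := fun x hx =>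
    (hasDerivAt_ofZero hp hp1 (by simpa using hx)).differentiableAt.differentiableWithinAt
  have hEd : DifferentiableOn ℂ E (ball 0 1) :=
    ((hed.comp hofz fun x hx => by
      simpa using norm_ofZero_lt hp hp1 (by simpa using hx)).mul
      ((differentiableOn_id.const_mul _).const_add 1)).div_const _
  have hof : ofZero p (-p) = 0 := by simp [ofZero]
  refine ⟨E, ⟨hEd, ?_, ?_, ?_⟩, ?_, ?_, hEF⟩
  · rw [hE]
    simpa [ofZero, hp2] using hep
  · intro x hx y hy hxy
    rw [mem_puncturedDisc] at hx hy
    simp only [hEF x hx.1 hx.2, hEF y hy.1 hy.2] at hxy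
    have hx' := norm_ofZero_lt hp hp1 hx.1
    have hy' := norm_ofZero_lt hp hp1 hy.1
    have h1 := hf.coe_eq hp hp1 hx' fun h => hx.2 ((ofZero_eq_iff hp hp1 hx.1).1 h)
    have h2 := hf.coe_eq hp hp1 hy' fun h => hy.2 ((ofZero_eq_iff hp hp1 hy.1).1 h)
    rw [hxy, ← h2] at h1
    have h3 := (Complex.UnitDisc.mk_inj hx' hy').1 (hf.injective h1)
    rw [← toZero_ofZero hp hp1 hx.1, h3, toZero_ofZero hp hp1 hy.1]
  · obtain ⟨K, hK, hKf⟩ := hf.convex_compl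
    convert hK using 1
    ext w
    have hw : w ∈ K ↔ (w : OnePoint ℂ) ∉ Set.range f := by
      rw [← mem_compl_iff, hKf]
      exact (OnePoint.coe_injective.mem_set_image).symm
    rw [hw, mem_compl_iff, not_iff_not]
    constructor
    · rintro ⟨x, hx, rfl⟩
      rw [mem_puncturedDisc] at hx
      simp only
      rw [hEF x hx.1 hx.2]
      exact ⟨.mk _ (norm_ofZero_lt hp hp1 hx.1), hf.coe_eq hp hp1 _
        fun h => hx.2 ((ofZero_eq_iff hp hp1 hx.1).1 h)⟩
    · rintro ⟨z, hz⟩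
      have hzp : (z : ℂ) ≠ p := by
        intro h
        rw [(hf.eq_infty_iff hp hp1).2 h] at hz
        exact OnePoint.infty_ne_coe _ hz
      have hx := norm_toZero_lt hp hp1 z.norm_lt_one
      have hx0 : toZero p z ≠ 0 := fun h => hzp ((toZero_eq_zero_iff hp hp1 z.norm_lt_one).1 h)
      refine ⟨toZero p z, mem_puncturedDisc.2 ⟨hx, hx0⟩, ?_⟩
      simp only
      rw [hEF _ hx hx0, ofZero_toZero hp hp1 z.norm_lt_one]
      exact finitePart_of_eq_coe z.norm_lt_one (by simpa using hz)
  · rw [hE]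
    simp only
    rw [hof, he 0 hp0.symm, hf0]
    simp
  · have h1 : HasDerivAt e (-p : ℂ) 0 := by
      have h2 : HasDerivAt (finitePart f) 1 0 := by
        rw [← hf.deriv_zero]
        exact (hf.analyticAt hp hp1 h00 hp0.symm).differentiableAt.hasDerivAt
      have h3 := ((hasDerivAt_id (0 : ℂ)).sub_const (p : ℂ)).mul h2
      rw [hf0] at h3
      refine (h3.congr_of_eventuallyEq ?_).congr_deriv (by simp)
      filter_upwards [isOpen_compl_singleton.mem_nhds hp0.symm] with w hw using he w hw
    have he0 : e 0 = 0 := by rw [he 0 hp0.symm, hf0, mul_zero]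
    have h4 := hasDerivAt_ofZero hp hp1 hnp
    have h5 : HasDerivAt (fun x => e (ofZero p x))
        (-p * ((1 - p ^ 2) / (1 + p * -p) ^ 2)) (-p : ℂ) :=
      HasDerivAt.comp (-p : ℂ) (h₂ := e) (h := ofZero p) (by rw [hof]; exact h1) h4
    have h6 := (h5.mul (((hasDerivAt_id (-p : ℂ)).const_mul (p : ℂ)).const_add 1)).div_const
      (1 - p ^ 2 : ℂ)
    have h7 : HasDerivAt E (-p / (1 - p ^ 2)) (-p : ℂ) := by
      refine h6.congr_deriv ?_
      rw [hof, he0, zero_mul, add_zero, show (1 + (p : ℂ) * -p) = 1 - p ^ 2 by ring]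
      simp only [id]
      rw [show (1 + (p : ℂ) * -p) = 1 - p ^ 2 by ring]
      field_simp
    exact h7.deriv

/-- The representation of `Co(p)` by functions bounded by one. -/
theorem exists_eq_rep : ∃ ω : ℂ → ℂ, DifferentiableOn ℂ ω (ball 0 1) ∧
    (∀ z, ‖z‖ < 1 → ‖ω z‖ ≤ 1) ∧ ‖deriv ω p‖ * (1 - p ^ 2) ≤ 1 - ‖ω p‖ ^ 2 ∧
    f = rep p fun z => ω z := by
  obtain ⟨E, hE, hE0, hE', hEF⟩ := hf.exists_concaveAtZero hp hp1
  obtain ⟨Ω, hΩ, hΩ1, hΩE⟩ := hE.exists_representation hp hp1 hE0 hE'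
  have hp0 := ofReal_ne_zero_of_pos hp
  have hp2 := one_sub_sq_ne_zero hp hp1
  have hp2' := one_add_sq_ne_zero p
  have hpn : ‖(p : ℂ)‖ < 1 := by simpa [abs_of_pos hp] using hp1
  have hp2pos : 0 < 1 - p ^ 2 := by nlinarith
  have hto : DifferentiableOn ℂ (toZero p) (ball 0 1) := fun x hx =>
    (hasDerivAt_toZero hp hp1 (by simpa using hx)).differentiableAt.differentiableWithinAt
  have htop : toZero p p = 0 := by simp [toZero]
  refine ⟨fun z => Ω (toZero p z), ?_, ?_, ?_, ?_⟩
  · exact hΩ.comp hto fun x hx => by simpa using norm_toZero_lt hp hp1 (by simpa using hx)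
  · exact fun z hz => hΩ1 _ (norm_toZero_lt hp hp1 hz)
  · have h1 : HasDerivAt (fun z => Ω (toZero p z))
        (deriv Ω 0 * ((1 - p ^ 2) / (1 - p * p) ^ 2)) (p : ℂ) :=
      HasDerivAt.comp (p : ℂ) (h₂ := Ω) (h := toZero p)
        (by rw [htop]; exact (hΩ.differentiableAt (ball_mem_nhds 0 one_pos)).hasDerivAt)
        (hasDerivAt_toZero hp hp1 hpn)
    have h2 : (deriv Ω 0 * ((1 - p ^ 2) / (1 - p * p) ^ 2) : ℂ) =
        deriv Ω 0 / ((1 - p ^ 2 : ℝ) : ℂ) := by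
      push_cast
      rw [show (1 - (p : ℂ) * p) = 1 - p ^ 2 by ring]
      field_simp
    rw [h1.deriv, h2, norm_div, Complex.norm_real, Real.norm_of_nonneg hp2pos.le,
      div_mul_cancel₀ _ hp2pos.ne']
    simp only [htop]
    exact norm_deriv_le_one_sub_sq hΩ hΩ1
  · funext z
    rw [rep]
    split_ifs with hzp
    · exact (hf.eq_infty_iff hp hp1).2 hzp
    · have hz := z.norm_lt_one
      have hx := norm_toZero_lt hp hp1 hz
      have hx0 : toZero p z ≠ 0 := fun h => hzp ((toZero_eq_zero_iff hp hp1 hz).1 h)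
      have h1 := hf.coe_eq hp hp1 hz hzp
      rw [Complex.UnitDisc.mk_coe] at h1
      rw [h1, ← ofZero_toZero hp hp1 hz, ← hEF _ hx hx0, hΩE _ hx, ofZero_toZero hp hp1 hz]
      congr 1
      have h3 := one_sub_mul_ne_zero hp hp1 hz
      have h4 : (z : ℂ) - p ≠ 0 := sub_ne_zero.2 hzp
      have h5 : 1 - (z : ℂ) / p ≠ 0 := by
        rw [one_sub_div hp0, div_ne_zero_iff]
        exact ⟨fun h => h4 (by linear_combination -h), hp0⟩
      have h6 : 1 - (z : ℂ) * p ≠ 0 := by rwa [mul_comm]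
      beta_reduce
      generalize Ω (toZero p z) = c
      have e1 : (1 - p ^ 4 : ℂ) = (1 - p ^ 2) * (1 + p ^ 2) := by ring
      have e2 : (1 - (z : ℂ) / p) = -((z - p) / p) := by field_simp; ring
      have e3 : toZero p z + p = z * (1 - p ^ 2) / (1 - p * z) := by
        rw [toZero]; field_simp; ring
      have e4 : 1 + p ^ 3 * toZero p z - p * c * (p + toZero p z) =
          (1 - p ^ 2) * (1 + p ^ 2 - p * z * (1 + c)) / (1 - p * z) := by
        rw [toZero]; field_simp; ring
      rw [e4, e3, e2, e1, toZero, mul_comm (z : ℂ) (p : ℂ)]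
      field_simp

end IsConcave

/-! ### Laurent coefficients -/

/-- Multiplying by `z - p` turns the expansion into an ordinary power series with index shifted by
one. -/
theorem hasLaurentExpansion_iff {p : ℝ} {f : 𝔻 → OnePoint ℂ} {a : ℤ → ℂ} :
    HasLaurentExpansion p f a ↔ (∀ n : ℤ, n < -1 → a n = 0) ∧
      ∀ z : ℂ, 0 < ‖z - (p : ℂ)‖ → ‖z - (p : ℂ)‖ < 1 - p →
        HasSum (fun n : ℕ => (z - (p : ℂ)) ^ n * a (n - 1)) ((z - p) * finitePart f z) := by
  refine and_congr_right fun h0 => forall_congr' fun z => forall_congr' fun hz =>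
    forall_congr' fun _ => ?_
  have hz0 : z - p ≠ 0 := norm_pos_iff.1 hz
  have hinj : Function.Injective fun n : ℕ => (n : ℤ) - 1 := fun m n h => by
    simpa using h
  have hsupp : ∀ n ∉ Set.range (fun n : ℕ => (n : ℤ) - 1), a n * (z - (p : ℂ)) ^ n = 0 := by
    intro n hn
    rw [h0 n, zero_mul]
    by_contra! h
    exact hn ⟨(n + 1).toNat, by
      simp only
      omega⟩
  rw [← hinj.hasSum_iff hsupp, ← hasSum_mul_left_iff hz0]
  refine Iff.of_eq (congrArg (fun g => HasSum g _) ?_)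
  funext n
  simp only [Function.comp_apply]
  rw [zpow_sub₀ hz0, zpow_natCast, zpow_one]
  field_simp

theorem eq_zero_of_hasSum_zero {c : ℕ → ℂ} {r : ℝ} (hr : 0 < r)
    (h : ∀ w : ℂ, 0 < ‖w‖ → ‖w‖ < r → HasSum (fun n => w ^ n * c n) 0) : c = 0 := by
  classical
  -- The hypothesis says nothing at `w = 0`, where the series sums to `c 0`; continuity of the sum
  -- forces `c 0 = 0`.
  set g : ℂ → ℂ := fun w => if w = 0 then c 0 else 0 with hg
  have hps : HasFPowerSeriesAt g (FormalMultilinearSeries.ofScalars ℂ c) 0 := by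
    rw [hasFPowerSeriesAt_iff]
    filter_upwards [ball_mem_nhds (0 : ℂ) hr] with w hw
    simp only [FormalMultilinearSeries.coeff_ofScalars, zero_add, smul_eq_mul]
    by_cases hw0 : w = 0
    · subst hw0
      simp only [hg, if_true]
      simpa using hasSum_single (f := fun n => (0 : ℂ) ^ n * c n) 0 fun n hn => by simp [hn]
    · simp only [hg, if_neg hw0]
      exact h w (norm_pos_iff.2 hw0) (by simpa using hw)
  have hcont : Tendsto g (𝓝[≠] 0) (𝓝 (g 0)) :=
    hps.continuousAt.tendsto.mono_left nhdsWithin_le_nhds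
  have hzero : Tendsto g (𝓝[≠] 0) (𝓝 0) :=
    tendsto_const_nhds.congr' <| by
      filter_upwards [self_mem_nhdsWithin] with w hw
      simp only [hg]
      rw [if_neg (show w ≠ 0 from hw)]
  have hc0 : c 0 = 0 := by simpa [hg] using tendsto_nhds_unique hcont hzero
  have hg0 : g = 0 := by
    funext w
    simp [hg, hc0]
  rw [hg0] at hps
  funext n
  have h1 : (FormalMultilinearSeries.ofScalars ℂ c).coeff n = 0 := by
    rw [hps.eq_zero]
    rfl
  rwa [FormalMultilinearSeries.coeff_ofScalars] at h1

section Laurent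

variable {p : ℝ} {f : 𝔻 → OnePoint ℂ} (hp : 0 < p) (hp1 : p < 1)

include hp1 in
theorem HasLaurentExpansion.unique {a b : ℤ → ℂ} (ha : HasLaurentExpansion p f a)
    (hb : HasLaurentExpansion p f b) : a = b := by
  rw [hasLaurentExpansion_iff] at ha hb
  have h : (fun n : ℕ => a (n - 1) - b (n - 1)) = 0 := by
    refine eq_zero_of_hasSum_zero (r := 1 - p) (by linarith) fun w hw hw1 => ?_
    have h1 := ha.2 (w + p) (by simpa using hw) (by simpa using hw1)
    have h2 := hb.2 (w + p) (by simpa using hw) (by simpa using hw1)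
    have h3 := h1.sub h2
    simpa [mul_sub] using h3
  funext n
  by_cases hn : n < -1
  · rw [ha.1 n hn, hb.1 n hn]
  · have h1 := congrFun h (n + 1).toNat
    have h2 : (((n + 1).toNat : ℕ) : ℤ) - 1 = n := by omega
    simp only [h2, Pi.zero_apply] at h1
    exact sub_eq_zero.1 h1

variable {e : ℂ → ℂ} (hed : DifferentiableOn ℂ e (ball 0 1))
  (he : ∀ z : ℂ, ‖z‖ < 1 → z ≠ p → e z = (z - p) * finitePart f z)
include hp hed he

/-- These are the Taylor coefficients of `e` at `p`, shifted by one. The guard is needed because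
`toNat` sends every `n + 1 < 0` to `0`. -/
theorem hasLaurentExpansion_iteratedDeriv : HasLaurentExpansion p f fun n : ℤ =>
    if n < -1 then 0 else ((n + 1).toNat.factorial : ℂ)⁻¹ * iteratedDeriv (n + 1).toNat e p := by
  rw [hasLaurentExpansion_iff]
  refine ⟨fun n hn => if_pos hn, fun z hz hz1 => ?_⟩
  have hsub : ball (p : ℂ) (1 - p) ⊆ ball 0 1 := by
    refine ball_subset_ball' ?_
    simp [abs_of_pos hp]
  have hzb : z ∈ ball (p : ℂ) (1 - p) := by rwa [mem_ball, dist_eq_norm]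
  have h1 := Complex.hasSum_taylorSeries_on_ball (hed.mono hsub) hzb
  rw [he z (by simpa using hsub hzb) (sub_ne_zero.1 (norm_pos_iff.1 hz))] at h1
  refine (congrArg (fun g => HasSum g ((z - p) * finitePart f z)) (funext fun n => ?_)).mp h1
  rw [if_neg (by omega : ¬ (n : ℤ) - 1 < -1)]
  simp only [sub_add_cancel, Int.toNat_natCast, smul_eq_mul]
  ring

include hp1

theorem hasLaurentExpansion_iff_eq (a : ℤ → ℂ) :
    HasLaurentExpansion p f a ↔ a = laurentCoeff p f := by
  have hex : ∃ a, HasLaurentExpansion p f a :=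
    ⟨_, hasLaurentExpansion_iteratedDeriv hp hed he⟩
  have h1 : HasLaurentExpansion p f (laurentCoeff p f) := by
    rw [laurentCoeff, dif_pos hex]
    exact hex.choose_spec
  constructor
  · exact fun h => h.unique hp1 h1
  · rintro rfl
    exact h1

theorem laurentCoeff_zero : laurentCoeff p f 0 = deriv e p := by
  rw [← (hasLaurentExpansion_iff_eq hp hp1 hed he _).1
    (hasLaurentExpansion_iteratedDeriv hp hed he)]
  simp [iteratedDeriv_one]

end Laurent

/-! ### The coefficient `a_0` of a represented function -/

theorem finitePart_rep {p : ℝ} (ω : ℂ → ℂ) {z : ℂ} (hz : ‖z‖ < 1) (hp : 0 < p) :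
    finitePart (rep p fun z => ω z) z =
      (z - p / (1 + p ^ 2) * (1 + ω z) * z ^ 2) / ((1 - z / p) * (1 - z * p)) := by
  rw [finitePart, dif_pos hz, rep, Complex.UnitDisc.coe_mk]
  split_ifs with h
  -- At the pole both sides are zero by convention: `∞` is replaced by `0`, and the quotient has
  -- denominator zero.
  · have hp0 := ofReal_ne_zero_of_pos hp
    rw [h, div_self hp0]
    simp
  · rfl

section Rep

variable {p : ℝ} (hp : 0 < p) (hp1 : p < 1)
include hp hp1

theorem differentiableOn_regular {ω : ℂ → ℂ} (hω : DifferentiableOn ℂ ω (ball 0 1)) :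
    DifferentiableOn ℂ (fun z => -p * (z - p / (1 + p ^ 2) * (1 + ω z) * z ^ 2) / (1 - z * p))
      (ball 0 1) := by
  refine DifferentiableOn.div ?_ (by fun_prop) fun z hz => ?_
  · fun_prop
  · rw [mul_comm]
    exact one_sub_mul_ne_zero hp hp1 (by simpa using hz)

theorem regular_eq {ω : ℂ → ℂ} {z : ℂ} (hz : ‖z‖ < 1) (hzp : z ≠ p) :
    -p * (z - p / (1 + p ^ 2) * (1 + ω z) * z ^ 2) / (1 - z * p) =
      (z - p) * finitePart (rep p fun z => ω z) z := by
  rw [finitePart_rep ω hz hp]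
  have hp0 := ofReal_ne_zero_of_pos hp
  have h1 : 1 - z * p ≠ 0 := by
    rw [mul_comm]
    exact one_sub_mul_ne_zero hp hp1 hz
  have h2 : z - p ≠ 0 := sub_ne_zero.2 hzp
  have e2 : 1 - z / p = -((z - p) / p) := by
    field_simp
    ring
  have h3 := one_add_sq_ne_zero p
  rw [e2]
  field_simp

/-- The coefficient `a_0` in terms of the bounded function. -/
theorem laurentCoeff_zero_rep {ω : ℂ → ℂ} (hω : DifferentiableOn ℂ ω (ball 0 1)) :
    ((1 - p ^ 2) / p : ℝ) * laurentCoeff p (rep p fun z => ω z) 0 +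
      ((1 - p ^ 2 + p ^ 4) / (1 - p ^ 4) : ℝ) =
      (p ^ 2 * (2 - p ^ 2) / (1 - p ^ 4) : ℝ) * ω p + (p ^ 3 / (1 + p ^ 2) : ℝ) * deriv ω p := by
  have hpn : ‖(p : ℂ)‖ < 1 := by simpa [abs_of_pos hp] using hp1
  have hωp : HasDerivAt ω (deriv ω p) p :=
    (hω.differentiableAt (isOpen_ball.mem_nhds (by simpa using hpn))).hasDerivAt
  have hp0 := ofReal_ne_zero_of_pos hp
  have hp2 := one_sub_sq_ne_zero hp hp1
  have hp2' := one_add_sq_ne_zero p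
  have h1 : (1 - p * p : ℂ) ≠ 0 := by rwa [← sq]
  rw [laurentCoeff_zero hp hp1 (differentiableOn_regular hp hp1 hω)
    fun z hz hzp => regular_eq hp hp1 hz hzp]
  have hd := (((hasDerivAt_id (p : ℂ)).sub
    (((hωp.const_add 1).const_mul (p / (1 + p ^ 2) : ℂ)).mul
      ((hasDerivAt_id (p : ℂ)).pow 2))).const_mul (-p : ℂ)).div
      (((hasDerivAt_id (p : ℂ)).mul_const (p : ℂ)).const_sub 1) h1
  have hd' := hd.deriv
  have e0 : deriv (fun z : ℂ => -p * (z - p / (1 + p ^ 2) * (1 + ω z) * z ^ 2) / (1 - z * p)) p =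
    _ := hd'
  rw [e0]
  have e4 : (1 - p ^ 4 : ℂ) = (1 - p ^ 2) * (1 + p ^ 2) := by ring
  simp only [id, Pi.pow_apply, Pi.sub_apply, Pi.mul_apply]
  push_cast
  rw [e4, show (1 - p * p : ℂ) = 1 - p ^ 2 by ring]
  field_simp
  ring

end Rep

/-! ### Joukowski maps: constants give members of `Co p` -/

theorem inv_add_mul_injOn {δ : ℂ} (hδ : ‖δ‖ ≤ 1) {x y : ℂ} (hx : ‖x‖ < 1) (hy : ‖y‖ < 1)
    (hx0 : x ≠ 0) (hy0 : y ≠ 0) (h : x⁻¹ + δ * x = y⁻¹ + δ * y) : x = y := by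
  have h1 : (y - x) * (1 - δ * (x * y)) = 0 := by
    field_simp at h
    linear_combination h
  rcases mul_eq_zero.1 h1 with h2 | h2
  · linear_combination -h2
  · exfalso
    have h3 := congrArg norm (show δ * (x * y) = 1 by linear_combination -h2)
    rw [norm_mul, norm_mul, norm_one] at h3
    have h4 : ‖x‖ * ‖y‖ < 1 := mul_lt_one_of_nonneg_of_lt_one_left (norm_nonneg _) hx hy.le
    nlinarith [norm_nonneg δ, norm_nonneg x, norm_nonneg y, mul_nonneg (norm_nonneg x) (norm_nonneg y)]

/-- Solving the equation together with its conjugate gives `u` explicitly when `|a b| < 1`. With `s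
= |a|`, `t = |b|`, the bound on `u` reduces to `s + t ≤ 1 + s t`, that is `(1 - s)(1 - t) ≥ 0`. -/
theorem exists_add_eq_conj_add {a b : ℂ} (ha : ‖a‖ ≤ 1) (hb : ‖b‖ ≤ 1) :
    ∃ u : ℂ, ‖u‖ ≤ 1 ∧ a + b = (starRingEnd ℂ) u + a * b * u := by
  by_cases hab : ‖a‖ * ‖b‖ = 1
  · have ha1 : ‖a‖ = 1 := by nlinarith [norm_nonneg a, norm_nonneg b]
    refine ⟨(starRingEnd ℂ) a, by simpa using ha, ?_⟩
    have : a * (starRingEnd ℂ) a = 1 := by rw [Complex.mul_conj', ha1]; simp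
    rw [Complex.conj_conj]
    linear_combination -b * this
  · have hlt : ‖a‖ * ‖b‖ < 1 :=
      lt_of_le_of_ne (mul_le_one₀ ha (norm_nonneg _) hb) hab
    have hx := norm_nonneg a
    have hy := norm_nonneg b
    have hpos : 0 < 1 - ‖a‖ ^ 2 * ‖b‖ ^ 2 := by nlinarith [mul_nonneg hx hy]
    have hne : ((1 - ‖a‖ ^ 2 * ‖b‖ ^ 2 : ℝ) : ℂ) ≠ 0 := by exact_mod_cast hpos.ne'
    have ha2 : (1 - ‖a‖ ^ 2 : ℝ) ≥ 0 := by nlinarith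
    have hb2 : (1 - ‖b‖ ^ 2 : ℝ) ≥ 0 := by nlinarith
    refine ⟨((starRingEnd ℂ) a * ((1 - ‖b‖ ^ 2 : ℝ) : ℂ) +
      (starRingEnd ℂ) b * ((1 - ‖a‖ ^ 2 : ℝ) : ℂ)) / ((1 - ‖a‖ ^ 2 * ‖b‖ ^ 2 : ℝ) : ℂ), ?_, ?_⟩
    · rw [norm_div, Complex.norm_real, Real.norm_of_nonneg hpos.le, div_le_one hpos]
      refine (norm_add_le _ _).trans ?_
      rw [norm_mul, norm_mul, RCLike.norm_conj, RCLike.norm_conj, Complex.norm_real,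
        Complex.norm_real, Real.norm_of_nonneg ha2, Real.norm_of_nonneg hb2]
      have : 0 ≤ (1 - ‖a‖) * (1 - ‖b‖) := mul_nonneg (by linarith) (by linarith)
      nlinarith
    · have e1 : a * (starRingEnd ℂ) a = ((‖a‖ ^ 2 : ℝ) : ℂ) := by rw [Complex.mul_conj']; simp
      have e2 : b * (starRingEnd ℂ) b = ((‖b‖ ^ 2 : ℝ) : ℂ) := by rw [Complex.mul_conj']; simp
      simp only [map_div₀, map_add, map_mul, Complex.conj_conj, Complex.conj_ofReal]
      rw [mul_div_assoc', ← add_div, eq_div_iff hne]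
      push_cast at e1 e2 ⊢
      linear_combination (-b * (1 - (‖b‖ : ℂ) ^ 2)) * e1 + (-a * (1 - (‖a‖ : ℂ) ^ 2)) * e2

/-- The image of the punctured disc under `x ↦ x⁻¹ + δ x` is the complement of an ellipse. -/
theorem exists_eq_inv_add_mul_iff {δ : ℂ} (hδ : ‖δ‖ ≤ 1) (w : ℂ) :
    (∃ x : ℂ, ‖x‖ < 1 ∧ x ≠ 0 ∧ x⁻¹ + δ * x = w) ↔
      ¬ ∃ u : ℂ, ‖u‖ ≤ 1 ∧ (starRingEnd ℂ) u + δ * u = w := by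
  constructor
  · rintro ⟨x, hx, hx0, rfl⟩ ⟨u, hu, huw⟩
    have h1 : 1 - (starRingEnd ℂ) u * x = x * (δ * (u - x)) := by
      field_simp at huw
      linear_combination -huw
    -- The difference of squares is `(1 - |u|²)(1 - |x|²)`. With `|δ| ≤ 1` and `|x| < 1` this
    -- contradicts `h1`.
    have h2 : ‖u - x‖ ≤ ‖1 - (starRingEnd ℂ) u * x‖ := by
      rw [← sq_le_sq₀ (norm_nonneg _) (norm_nonneg _), Complex.sq_norm, Complex.sq_norm]
      have e1 : Complex.normSq u ≤ 1 := by
        rw [Complex.normSq_eq_norm_sq]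
        exact pow_le_one₀ (norm_nonneg _) hu
      have e2 : Complex.normSq x ≤ 1 := by
        rw [Complex.normSq_eq_norm_sq]
        exact pow_le_one₀ (norm_nonneg _) hx.le
      rw [Complex.normSq_apply] at e1 e2 ⊢
      rw [Complex.normSq_apply]
      simp only [Complex.sub_re, Complex.sub_im, Complex.one_re, Complex.one_im, Complex.mul_re,
        Complex.mul_im, Complex.conj_re, Complex.conj_im]
      nlinarith [mul_nonneg (sub_nonneg.2 e1) (sub_nonneg.2 e2)]
    have h3 := congrArg norm h1
    rw [norm_mul, norm_mul] at h3
    have h4 : 0 < ‖1 - (starRingEnd ℂ) u * x‖ := by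
      rw [norm_pos_iff]
      intro h
      have h5 := congrArg norm (show (starRingEnd ℂ) u * x = 1 by linear_combination -h)
      rw [norm_mul, RCLike.norm_conj, norm_one] at h5
      nlinarith [norm_nonneg x, norm_nonneg u]
    have h5 : ‖δ‖ * ‖u - x‖ ≤ ‖1 - (starRingEnd ℂ) u * x‖ :=
      (mul_le_of_le_one_left (norm_nonneg _) hδ).trans h2
    nlinarith [norm_nonneg x]
  · intro hno
    -- The roots `a`, `b` of `t² - w t + δ` are the candidates for `x⁻¹`. A root outside the closed
    -- unit disc gives a preimage; if both lie inside, `w` is in the ellipse.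
    obtain ⟨a, ha⟩ : ∃ a : ℂ, a * a - w * a + δ = 0 := by
      obtain ⟨s, hs⟩ := IsAlgClosed.exists_pow_nat_eq (w ^ 2 - 4 * δ) (n := 2) (by norm_num)
      exact ⟨(w + s) / 2, by linear_combination hs / 4⟩
    obtain ⟨b, hb⟩ : ∃ b : ℂ, b = w - a := ⟨_, rfl⟩
    have hw : w = a + b := by rw [hb]; ring
    have hab : δ = a * b := by rw [hb]; linear_combination ha
    by_cases ha1 : ‖a‖ ≤ 1
    · by_cases hb1 : ‖b‖ ≤ 1
      · obtain ⟨u, hu, h⟩ := exists_add_eq_conj_add ha1 hb1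
        exact absurd ⟨u, hu, by rw [hab, hw, h]⟩ hno
      · have hb0 : b ≠ 0 := by
          rintro rfl
          simp at hb1
        refine ⟨b⁻¹, by rw [norm_inv]; exact inv_lt_one_of_one_lt₀ (not_le.1 hb1),
          inv_ne_zero hb0, ?_⟩
        rw [inv_inv, hab, hw]
        field_simp
        ring
    · have ha0 : a ≠ 0 := by
        rintro rfl
        simp at ha1
      refine ⟨a⁻¹, by rw [norm_inv]; exact inv_lt_one_of_one_lt₀ (not_le.1 ha1),
        inv_ne_zero ha0, ?_⟩
      rw [inv_inv, hab, hw]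
      field_simp

section

variable {p : ℝ} (hp : 0 < p) (hp1 : p < 1) {c : ℂ} (hc : ‖c‖ ≤ 1)
include hp hp1 hc

theorem one_sub_mul_sq_ne_zero : 1 - c * p ^ 2 ≠ 0 := by
  intro h
  have h1 := congrArg norm (show c * (p : ℂ) ^ 2 = 1 by linear_combination -h)
  rw [norm_mul, norm_pow, Complex.norm_real, Real.norm_of_nonneg hp.le, norm_one] at h1
  nlinarith [norm_nonneg c, sq_nonneg p]

theorem norm_sq_sub_div_le : ‖(p ^ 2 - c) / (1 - c * p ^ 2)‖ ≤ 1 := by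
  rw [norm_div]
  refine div_le_one_of_le₀ ?_ (norm_nonneg _)
  rw [← sq_le_sq₀ (norm_nonneg _) (norm_nonneg _), Complex.sq_norm, Complex.sq_norm]
  have h1 : Complex.normSq c ≤ 1 := by
    rw [Complex.normSq_eq_norm_sq]
    exact pow_le_one₀ (norm_nonneg _) hc
  rw [Complex.normSq_apply] at h1 ⊢
  rw [Complex.normSq_apply]
  have e : (p : ℂ) ^ 2 = ((p ^ 2 : ℝ) : ℂ) := by push_cast; ring
  rw [e]
  simp only [Complex.sub_re, Complex.sub_im, Complex.ofReal_re, Complex.ofReal_im,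
    Complex.one_re, Complex.one_im, Complex.re_mul_ofReal, Complex.im_mul_ofReal]
  have h2 : (p ^ 2) ^ 2 ≤ 1 := pow_le_one₀ (by positivity) (by nlinarith)
  nlinarith

/-- In the coordinate `toZero p z` the rational functions with constant `c` are Joukowski maps. -/
theorem rep_const_eq {z : ℂ} (hz : ‖z‖ < 1) (hzp : z ≠ p) :
    (z - p / (1 + p ^ 2) * (1 + c) * z ^ 2) / ((1 - z / p) * (1 - z * p)) =
      -p ^ 2 * (1 - c * p ^ 2) / ((1 - p ^ 2) * (1 - p ^ 4)) *
        ((toZero p z)⁻¹ + (p ^ 2 - c) / (1 - c * p ^ 2) * toZero p z) +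
      -p * (1 + p ^ 4 - 2 * c * p ^ 2) / ((1 - p ^ 2) * (1 - p ^ 4)) := by
  have hp0 := ofReal_ne_zero_of_pos hp
  have hp2 := one_sub_sq_ne_zero hp hp1
  have hp2' := one_add_sq_ne_zero p
  have hcp := one_sub_mul_sq_ne_zero hp hp1 hc
  have h1 := one_sub_mul_ne_zero hp hp1 hz
  have h1' : 1 - z * p ≠ 0 := by rwa [mul_comm]
  have h2 : z - p ≠ 0 := sub_ne_zero.2 hzp
  have e1 : (1 - p ^ 4 : ℂ) = (1 - p ^ 2) * (1 + p ^ 2) := by ring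
  have e2 : 1 - z / p = -((z - p) / p) := by field_simp; ring
  have e3 : -p ^ 2 * (1 - c * p ^ 2) / ((1 - p ^ 2) * (1 - p ^ 4)) *
        ((toZero p z)⁻¹ + (p ^ 2 - c) / (1 - c * p ^ 2) * toZero p z) =
      -p ^ 2 / ((1 - p ^ 2) * (1 - p ^ 4)) *
        ((1 - c * p ^ 2) * (toZero p z)⁻¹ + (p ^ 2 - c) * toZero p z) := by
    have hcp' : 1 - p ^ 2 * c ≠ 0 := by rwa [mul_comm]
    generalize toZero p z = x
    field_simp
  rw [e3, e2, e1, toZero, inv_div]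
  field_simp
  ring

theorem rep_const_mem : IsConcave p (rep p fun _ => c) := by
  have hp0 := ofReal_ne_zero_of_pos hp
  have hp2 := one_sub_sq_ne_zero hp hp1
  have hp2' := one_add_sq_ne_zero p
  have hpn : ‖(p : ℂ)‖ < 1 := by simpa [abs_of_pos hp] using hp1
  have hcp := one_sub_mul_sq_ne_zero hp hp1 hc
  have hδ := norm_sq_sub_div_le hp hp1 hc
  set r : ℂ → ℂ := fun z =>
    (z - p / (1 + p ^ 2) * (1 + c) * z ^ 2) / ((1 - z / p) * (1 - z * p)) with hr
  set f := rep p fun _ => c with hf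
  set g : ℂ → ℂ := fun z => -p * (z - p / (1 + p ^ 2) * (1 + c) * z ^ 2) / (1 - z * p) with hg
  have hfr : ∀ {z : ℂ}, ‖z‖ < 1 → finitePart f z = r z := fun hz =>
    finitePart_rep (fun _ => c) hz hp
  have hfev : ∀ {z : ℂ}, ‖z‖ < 1 → finitePart f =ᶠ[𝓝 z] r := fun {z} hz => by
    filter_upwards [isOpen_ball.mem_nhds (show z ∈ ball (0 : ℂ) 1 by simpa using hz)] with w hw
    exact hfr (by simpa using hw)
  have hfp : ∀ {z : 𝔻}, (z : ℂ) = p → f z = ∞ := fun hz => by rw [hf, rep, if_pos hz]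
  have hfz : ∀ {z : 𝔻}, (z : ℂ) ≠ p → f z = (r z : OnePoint ℂ) := fun hz => by
    rw [hf, rep, if_neg hz]
  have hden : ∀ {z : ℂ}, ‖z‖ < 1 → z ≠ p → (1 - z / p) * (1 - z * p) ≠ 0 := by
    intro z hz hzp
    refine mul_ne_zero ?_ (by rw [mul_comm]; exact one_sub_mul_ne_zero hp hp1 hz)
    rw [one_sub_div hp0, div_ne_zero_iff]
    exact ⟨sub_ne_zero.2 hzp.symm, hp0⟩
  have hrd : ∀ {z : ℂ}, ‖z‖ < 1 → z ≠ p → AnalyticAt ℂ r z := by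
    intro z hz hzp
    exact AnalyticAt.div (by fun_prop) (by fun_prop) (hden hz hzp)
  have hga : AnalyticAt ℂ g p :=
    AnalyticAt.div (by fun_prop) (by fun_prop)
      (by rw [mul_comm]; exact one_sub_mul_ne_zero hp hp1 hpn)
  have hg0 : g p ≠ 0 := by
    have : g p = -p ^ 2 * (1 - c * p ^ 2) / ((1 + p ^ 2) * (1 - p ^ 2)) := by
      simp only [hg]
      rw [show (1 - p * p : ℂ) = 1 - p ^ 2 by ring]
      field_simp
      ring
    rw [this]
    exact div_ne_zero (mul_ne_zero (neg_ne_zero.2 (pow_ne_zero _ hp0)) hcp) (mul_ne_zero hp2' hp2)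
  have hfg : ∀ᶠ z in 𝓝[≠] (p : ℂ), finitePart f z = (z - p) ^ (-1 : ℤ) • g z := by
    rw [eventually_nhdsWithin_iff]
    filter_upwards [isOpen_ball.mem_nhds (show (p : ℂ) ∈ ball (0 : ℂ) 1 by simpa using hpn)]
      with z hz hzp
    have h1 := regular_eq (ω := fun _ => c) hp hp1 (by simpa using hz) hzp
    have h2 : z - p ≠ 0 := sub_ne_zero.2 hzp
    rw [zpow_neg_one, smul_eq_mul, eq_inv_mul_iff_mul_eq₀ h2]
    exact h1.symm
  have hmer : MeromorphicAt (finitePart f) p := by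
    have h1 : MeromorphicAt (fun z : ℂ => (z - p) ^ (-1 : ℤ) • g z) p :=
      ((MeromorphicAt.id _).sub (MeromorphicAt.const _ _)).zpow (-1) |>.smul hga.meromorphicAt
    exact h1.congr (hfg.mono fun z hz => hz.symm)
  have hord : meromorphicOrderAt (finitePart f) (p : ℂ) = -1 :=
    (meromorphicOrderAt_eq_int_iff (n := -1) hmer).2 ⟨g, hga, hg0, hfg⟩
  have hne : ∀ {z : ℂ}, ‖z‖ < 1 → z ≠ p → toZero p z ≠ 0 := fun hz hzp h =>
    hzp ((toZero_eq_zero_iff hp hp1 hz).1 h)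
  obtain ⟨α, hα⟩ : ∃ α : ℂ, α = -p ^ 2 * (1 - c * p ^ 2) / ((1 - p ^ 2) * (1 - p ^ 4)) := ⟨_, rfl⟩
  obtain ⟨β, hβ⟩ : ∃ β : ℂ, β = -p * (1 + p ^ 4 - 2 * c * p ^ 2) / ((1 - p ^ 2) * (1 - p ^ 4)) :=
    ⟨_, rfl⟩
  obtain ⟨δ, hδeq⟩ : ∃ δ : ℂ, δ = (p ^ 2 - c) / (1 - c * p ^ 2) := ⟨_, rfl⟩
  rw [← hδeq] at hδ
  have hJ : ∀ {z : ℂ}, ‖z‖ < 1 → z ≠ p → r z = α * ((toZero p z)⁻¹ + δ * toZero p z) + β := by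
    intro z hz hzp
    rw [hα, hβ, hδeq]
    exact rep_const_eq hp hp1 hc hz hzp
  have hα0 : α ≠ 0 := by
    rw [hα, show (1 - p ^ 4 : ℂ) = (1 - p ^ 2) * (1 + p ^ 2) by ring]
    exact div_ne_zero (mul_ne_zero (neg_ne_zero.2 (pow_ne_zero _ hp0)) hcp)
      (mul_ne_zero hp2 (mul_ne_zero hp2 hp2'))
  refine ⟨fun z => ⟨fun hz => ?_, fun hz => ?_⟩, hord, ?_, ?_, ?_, ?_⟩
  · have hzp : (z : ℂ) ≠ p := fun h => hz (hfp h)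
    exact (hrd z.norm_lt_one hzp).congr (hfev z.norm_lt_one).symm
  · have hzp : (z : ℂ) = p := by
      by_contra h
      rw [hfz h] at hz
      exact OnePoint.coe_ne_infty _ hz
    rw [hzp]
    exact ⟨hmer, by rw [hord]; decide⟩
  · rw [hfz (by simpa using hp0.symm)]
    simp [hr]
  · have h00 : ‖(0 : ℂ)‖ < 1 := by simp
    rw [(hfev h00).deriv_eq]
    have h1 : HasDerivAt (fun z : ℂ => z - p / (1 + p ^ 2) * (1 + c) * z ^ 2) 1 0 := by
      have := (hasDerivAt_id (0 : ℂ)).sub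
        (((hasDerivAt_id (0 : ℂ)).pow 2).const_mul (p / (1 + p ^ 2) * (1 + c) : ℂ))
      exact this.congr_deriv (by simp)
    have h2 : DifferentiableAt ℂ (fun z : ℂ => (1 - z / p) * (1 - z * p)) 0 := by fun_prop
    have h3 := h1.div h2.hasDerivAt (hden h00 hp0.symm)
    refine (h3.congr_deriv ?_).deriv
    simp
  · intro z w hzw
    by_cases hz : (z : ℂ) = p
    · by_cases hw : (w : ℂ) = p
      · exact Complex.UnitDisc.coe_injective (hz.trans hw.symm)
      · rw [hfp hz, hfz hw] at hzw
        exact absurd hzw (OnePoint.infty_ne_coe _)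
    · by_cases hw : (w : ℂ) = p
      · rw [hfp hw, hfz hz] at hzw
        exact absurd hzw (OnePoint.coe_ne_infty _)
      · rw [hfz hz, hfz hw, OnePoint.coe_eq_coe, hJ z.norm_lt_one hz, hJ w.norm_lt_one hw] at hzw
        have h1 := inv_add_mul_injOn hδ (norm_toZero_lt hp hp1 z.norm_lt_one)
          (norm_toZero_lt hp hp1 w.norm_lt_one) (hne z.norm_lt_one hz) (hne w.norm_lt_one hw)
          (mul_left_cancel₀ hα0 (add_right_cancel hzw))
        apply Complex.UnitDisc.coe_injective
        rw [← ofZero_toZero hp hp1 z.norm_lt_one, h1, ofZero_toZero hp hp1 w.norm_lt_one]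
  -- The omitted set is the image of the closed unit disc under a real-affine map, hence convex.
  · refine ⟨{w | ∃ u : ℂ, ‖u‖ ≤ 1 ∧ α * ((starRingEnd ℂ) u + δ * u) + β = w}, ?_, ?_⟩
    · rintro _ ⟨u, hu, rfl⟩ _ ⟨v, hv, rfl⟩ s t hs ht hst
      refine ⟨s • u + t • v, ?_, ?_⟩
      · have := convex_closedBall (0 : ℂ) 1 (x := u) (by simpa using hu) (y := v)
          (by simpa using hv) hs ht hst
        simpa using this
      · have hst' : (s : ℂ) + t = 1 := by exact_mod_cast hst
        simp only [Complex.real_smul, map_add, map_mul, Complex.conj_ofReal]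
        linear_combination (-β) * hst'
    · ext w
      induction w using OnePoint.rec with
      | infty =>
        have : (∞ : OnePoint ℂ) ∈ Set.range f := ⟨.mk p hpn, hfp rfl⟩
        simp [this]
      | coe w =>
        rw [OnePoint.coe_injective.mem_set_image, mem_compl_iff, mem_ofPred_eq, ← not_iff_not,
          not_not]
        have h1 := exists_eq_inv_add_mul_iff hδ ((w - β) / α)
        have h2 : (∃ u : ℂ, ‖u‖ ≤ 1 ∧ α * ((starRingEnd ℂ) u + δ * u) + β = w) ↔
            ∃ u : ℂ, ‖u‖ ≤ 1 ∧ (starRingEnd ℂ) u + δ * u = (w - β) / α := by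
          refine exists_congr fun u => and_congr_right fun _ => ?_
          rw [eq_div_iff hα0, eq_sub_iff_add_eq, mul_comm α]
        rw [h2, ← h1]
        constructor
        · rintro ⟨z, hz⟩
          have hzp : (z : ℂ) ≠ p := by
            intro h
            rw [hfp h] at hz
            exact OnePoint.infty_ne_coe _ hz
          refine ⟨toZero p z, norm_toZero_lt hp hp1 z.norm_lt_one, hne z.norm_lt_one hzp, ?_⟩
          rw [hfz hzp, OnePoint.coe_eq_coe, hJ z.norm_lt_one hzp] at hz
          rw [← hz]
          field_simp
          ring
        · rintro ⟨x, hx, hx0, hxw⟩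
          have hz := norm_ofZero_lt hp hp1 hx
          have hzp : ofZero p x ≠ p := fun h => hx0 ((ofZero_eq_iff hp hp1 hx).1 h)
          refine ⟨.mk _ hz, ?_⟩
          rw [hfz (z := .mk _ hz) hzp, OnePoint.coe_eq_coe, Complex.UnitDisc.coe_mk, hJ hz hzp,
            toZero_ofZero hp hp1 hx, hxw]
          field_simp
          ring

end

/-! ### The sharp bound and its equality case -/

section

variable {p : ℝ} (hp : 0 < p) (hp1 : p < 1)
include hp hp1

theorem laurentCoeff_zero_rep_const (c : ℂ) :
    ((1 - p ^ 2) / p : ℝ) * laurentCoeff p (rep p fun _ => c) 0 +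
      ((1 - p ^ 2 + p ^ 4) / (1 - p ^ 4) : ℝ) = (p ^ 2 * (2 - p ^ 2) / (1 - p ^ 4) : ℝ) * c := by
  have h := laurentCoeff_zero_rep hp hp1 (ω := fun _ => c) (differentiableOn_const c)
  rw [deriv_const, mul_zero, add_zero] at h
  exact h

theorem radius_pos : 0 < p ^ 2 * (2 - p ^ 2) / (1 - p ^ 4) := by
  have h1 : p ^ 2 < 1 := by nlinarith
  have h2 : p ^ 4 < 1 := pow_lt_one₀ hp.le hp1 (by norm_num)
  have : 0 < 2 - p ^ 2 := by linarith
  have : 0 < 1 - p ^ 4 := by linarith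
  positivity

theorem norm_laurentCoeff_rep_const (c : ℂ) :
    ‖((1 - p ^ 2) / p : ℝ) * laurentCoeff p (rep p fun _ => c) 0 +
      ((1 - p ^ 2 + p ^ 4) / (1 - p ^ 4) : ℝ)‖ = p ^ 2 * (2 - p ^ 2) / (1 - p ^ 4) * ‖c‖ := by
  rw [laurentCoeff_zero_rep_const hp hp1, norm_mul, Complex.norm_real,
    Real.norm_of_nonneg (radius_pos hp hp1).le]

/-- Every point of the disc is the coefficient of a function with constant `c`. -/
theorem exists_laurentCoeff_rep_eq {w : ℂ}
    (hw : ‖((1 - p ^ 2) / p : ℝ) * w + ((1 - p ^ 2 + p ^ 4) / (1 - p ^ 4) : ℝ)‖ ≤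
      p ^ 2 * (2 - p ^ 2) / (1 - p ^ 4)) :
    ∃ c : ℂ, ‖c‖ ≤ 1 ∧ laurentCoeff p (rep p fun _ => c) 0 = w := by
  have hR := radius_pos hp hp1
  have hR' : ((p ^ 2 * (2 - p ^ 2) / (1 - p ^ 4) : ℝ) : ℂ) ≠ 0 := by exact_mod_cast hR.ne'
  have hA : (((1 - p ^ 2) / p : ℝ) : ℂ) ≠ 0 := by
    have : ((1 - p ^ 2) / p : ℝ) ≠ 0 := div_ne_zero (by nlinarith) hp.ne'
    exact_mod_cast this
  obtain ⟨c, hc⟩ : ∃ c : ℂ, (p ^ 2 * (2 - p ^ 2) / (1 - p ^ 4) : ℝ) * c =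
      ((1 - p ^ 2) / p : ℝ) * w + ((1 - p ^ 2 + p ^ 4) / (1 - p ^ 4) : ℝ) :=
    ⟨_, mul_div_cancel₀ _ hR'⟩
  refine ⟨c, ?_, ?_⟩
  · rw [← hc, norm_mul, Complex.norm_real, Real.norm_of_nonneg hR.le] at hw
    exact (mul_le_iff_le_one_right hR).1 hw
  · have h := laurentCoeff_zero_rep_const hp hp1 c
    rw [hc] at h
    exact mul_left_cancel₀ hA (add_right_cancel h)

/-- The sharp bound for `a_0`, with the case of equality. -/
theorem IsConcave.norm_laurentCoeff_le {f : 𝔻 → OnePoint ℂ} (hf : IsConcave p f)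
    (hp3 : (p + 1) ^ 2 ≤ 3) :
    ‖((1 - p ^ 2) / p : ℝ) * laurentCoeff p f 0 + ((1 - p ^ 2 + p ^ 4) / (1 - p ^ 4) : ℝ)‖ ≤
        p ^ 2 * (2 - p ^ 2) / (1 - p ^ 4) ∧
      (‖((1 - p ^ 2) / p : ℝ) * laurentCoeff p f 0 +
          ((1 - p ^ 2 + p ^ 4) / (1 - p ^ 4) : ℝ)‖ = p ^ 2 * (2 - p ^ 2) / (1 - p ^ 4) →
        ∃ c : ℂ, ‖c‖ = 1 ∧ f = rep p fun _ => c) := by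
  obtain ⟨ω, hω, hω1, hω', rfl⟩ := hf.exists_eq_rep hp hp1
  have hpn : ‖(p : ℂ)‖ < 1 := by simpa [abs_of_pos hp] using hp1
  have hR := radius_pos hp hp1
  have hp2 : 0 < 1 - p ^ 2 := by nlinarith
  have hx := hω1 p hpn
  have hx0 := norm_nonneg (ω p)
  rw [laurentCoeff_zero_rep hp hp1 hω]
  have e4 : 1 - p ^ 4 = (1 - p ^ 2) * (1 + p ^ 2) := by ring
  -- The square is kept as a deficit so that equality forces `|ω p| = 1`.
  have hB : ‖((p ^ 2 * (2 - p ^ 2) / (1 - p ^ 4) : ℝ) : ℂ) * ω p +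
      ((p ^ 3 / (1 + p ^ 2) : ℝ) : ℂ) * deriv ω p‖ ≤
      p ^ 2 * (2 - p ^ 2) / (1 - p ^ 4) - p ^ 3 / (1 - p ^ 4) * (1 - ‖ω p‖) ^ 2 := by
    refine (norm_add_le _ _).trans ?_
    rw [norm_mul, norm_mul, Complex.norm_real, Complex.norm_real, Real.norm_of_nonneg hR.le,
      Real.norm_of_nonneg (by positivity)]
    have h1 : p ^ 3 / (1 + p ^ 2) * ‖deriv ω p‖ ≤ p ^ 3 / (1 - p ^ 4) * (1 - ‖ω p‖ ^ 2) := by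
      calc p ^ 3 / (1 + p ^ 2) * ‖deriv ω p‖
          = p ^ 3 / (1 - p ^ 4) * (‖deriv ω p‖ * (1 - p ^ 2)) := by
            rw [e4]
            field_simp
        _ ≤ p ^ 3 / (1 - p ^ 4) * (1 - ‖ω p‖ ^ 2) := by
            gcongr
            rw [e4]
            positivity
    -- The restriction on `p` enters here: `2 - 2 p - p² = 3 - (p + 1)²`.
    have h2 : 0 ≤ (p ^ 2 * ((2 - 2 * p - p ^ 2) * (1 - ‖ω p‖))) / (1 - p ^ 4) := by
      rw [e4]
      have : 0 ≤ 2 - 2 * p - p ^ 2 := by nlinarith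
      have : 0 ≤ 1 - ‖ω p‖ := by linarith
      positivity
    have h3 : p ^ 2 * (2 - p ^ 2) / (1 - p ^ 4) - p ^ 3 / (1 - p ^ 4) * (1 - ‖ω p‖) ^ 2 -
        (p ^ 2 * (2 - p ^ 2) / (1 - p ^ 4) * ‖ω p‖ + p ^ 3 / (1 - p ^ 4) * (1 - ‖ω p‖ ^ 2)) =
        (p ^ 2 * ((2 - 2 * p - p ^ 2) * (1 - ‖ω p‖))) / (1 - p ^ 4) := by
      ring
    linarith
  have hC : 0 < p ^ 3 / (1 - p ^ 4) := by
    rw [e4]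
    positivity
  refine ⟨hB.trans (by nlinarith [sq_nonneg (1 - ‖ω p‖)]), fun heq => ?_⟩
  rw [heq] at hB
  have h1 : (1 - ‖ω p‖) ^ 2 = 0 := by
    have h2 := sq_nonneg (1 - ‖ω p‖)
    by_contra hne
    have h3 : 0 < (1 - ‖ω p‖) ^ 2 := lt_of_le_of_ne h2 (Ne.symm hne)
    have := mul_pos hC h3
    linarith
  have h2 : ‖ω p‖ = 1 := by
    have := pow_eq_zero_iff (two_ne_zero) |>.1 h1
    linarith
  refine ⟨ω p, h2, ?_⟩
  congr 1
  funext z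
  exact eq_of_norm_eq_one hω hω1 hpn z.norm_lt_one h2

end

theorem exists_angle_of_norm_eq_one {c : ℂ} (hc : ‖c‖ = 1) :
    ∃ θ ∈ Set.Icc (0 : ℝ) (2 * Real.pi), Complex.exp (Complex.I * θ) = c := by
  have hc' : Complex.exp (Complex.I * (c.arg : ℝ)) = c := by
    have := Complex.norm_mul_exp_arg_mul_I c
    rw [hc, Complex.ofReal_one, one_mul] at this
    rwa [mul_comm]
  have h1 := Complex.neg_pi_lt_arg c
  have h2 := Complex.arg_le_pi c
  have h3 := Real.pi_pos
  by_cases h : 0 ≤ c.arg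
  · exact ⟨c.arg, ⟨h, by linarith⟩, hc'⟩
  · refine ⟨c.arg + 2 * Real.pi, ⟨by linarith, by linarith⟩, ?_⟩
    push_cast
    rw [mul_add, Complex.exp_add, hc', show Complex.I * (2 * Real.pi) = 2 * Real.pi * Complex.I by
      ring, Complex.exp_two_pi_mul_I, mul_one]

end Concave

end

theorem theorem2 (p : ℝ) (hp : 0 < p) (hp' : p ≤ √3 - 1) :
    -- the Laurent coefficients of every `f ∈ Co(p)` exist and are unique
    (∀ f ∈ Concave.Co p, ∀ a : ℤ → ℂ,
      Concave.HasLaurentExpansion p f a ↔ a = Concave.laurentCoeff p f) ∧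
    -- the exact set of values of `a_0(f)`, `f ∈ Co(p)`
    {w : ℂ | ∃ f ∈ Concave.Co p, Concave.laurentCoeff p f 0 = w} =
      {w : ℂ | ‖((1 - p ^ 2) / p : ℝ) * w + ((1 - p ^ 2 + p ^ 4) / (1 - p ^ 4) : ℝ)‖ ≤
        p ^ 2 * (2 - p ^ 2) / (1 - p ^ 4)} ∧
    -- the case of equality
    (∀ f ∈ Concave.Co p,
      ‖((1 - p ^ 2) / p : ℝ) * Concave.laurentCoeff p f 0 +
          ((1 - p ^ 2 + p ^ 4) / (1 - p ^ 4) : ℝ)‖ = p ^ 2 * (2 - p ^ 2) / (1 - p ^ 4) ↔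
        ∃ θ ∈ Set.Icc (0 : ℝ) (2 * Real.pi), f = Concave.extremal p θ) ∧
    -- the functions with constant `ω` belong to `Co(p)`
    (∀ c : ℂ, ‖c‖ ≤ 1 → Concave.rep p (fun _ => c) ∈ Concave.Co p) ∧
    -- and they attain every point of the disc
    (∀ w : ℂ, ‖((1 - p ^ 2) / p : ℝ) * w + ((1 - p ^ 2 + p ^ 4) / (1 - p ^ 4) : ℝ)‖ ≤
        p ^ 2 * (2 - p ^ 2) / (1 - p ^ 4) →
      ∃ c : ℂ, ‖c‖ ≤ 1 ∧ Concave.laurentCoeff p (Concave.rep p (fun _ => c)) 0 = w) := by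
  have hs3 : √3 ^ 2 = 3 := Real.sq_sqrt (by norm_num)
  have hs0 : 0 ≤ √3 := Real.sqrt_nonneg 3
  have hp1 : p < 1 := by nlinarith
  have hp3 : (p + 1) ^ 2 ≤ 3 := by nlinarith
  have hrep : ∀ c : ℂ, ‖c‖ ≤ 1 → Concave.rep p (fun _ => c) ∈ Concave.Co p := fun c hc =>
    Concave.rep_const_mem hp hp1 hc
  refine ⟨fun f hf a => ?_, ?_, fun f hf => ⟨fun h => ?_, ?_⟩, hrep, fun w hw =>
    Concave.exists_laurentCoeff_rep_eq hp hp1 hw⟩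
  · obtain ⟨e, hed, -, he⟩ := Concave.IsConcave.exists_regular hf hp hp1
    exact Concave.hasLaurentExpansion_iff_eq hp hp1 hed (fun z _ hz => he z hz) a
  · ext w
    constructor
    · rintro ⟨f, hf, rfl⟩
      exact (Concave.IsConcave.norm_laurentCoeff_le hp hp1 hf hp3).1
    · intro hw
      obtain ⟨c, hc, hcw⟩ := Concave.exists_laurentCoeff_rep_eq hp hp1 hw
      exact ⟨_, hrep c hc, hcw⟩
  · obtain ⟨c, hc, hfc⟩ := (Concave.IsConcave.norm_laurentCoeff_le hp hp1 hf hp3).2 h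
    obtain ⟨θ, hθ, hθc⟩ := Concave.exists_angle_of_norm_eq_one hc
    exact ⟨θ, hθ, by rw [hfc, Concave.extremal, hθc]⟩
  · rintro ⟨θ, -, rfl⟩
    rw [Concave.extremal, Concave.norm_laurentCoeff_rep_const hp hp1, mul_comm Complex.I,
      Complex.norm_exp_ofReal_mul_I, mul_one]
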